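/- Let $\Bbbk$ be a field, $n\ge 0$, and let $Q$ be the quiver $1\to 2\to\cdots\to n$ of type $\mathbb A_n$ with straight orientation; work in the category of finite-dimensional representations of $Q$ over $\Bbbk$, and write $\mathrm{Ext}$ for $\mathrm{Ext}^1$. For $0\le i<j\le n$ let $M_{i,j}$ be the representation with support $(i,j]=\{i+1,\dots,j\}$ that is $\Bbbk$ at each vertex of its support, with identity maps inside the support. A representation $V$ is exceptional if $\mathrm{End}(V)$ is a division ring and $\mathrm{Ext}^m(V,V)=0$ for all $m\ge1$. An exceptional sequence is a sequence $(E_1,\dots,E_n)$ of exceptional representations with $\mathrm{Hom}(E_l,E_m)=0=\mathrm{Ext}(E_l,E_m)$ for all $m<l$; its set of objects $\{E_1,\dots,E_n\}$ is called an exceptional set. The object $E_l$ is relatively injective if it is an injective object of the full subcategory of all $W$ with $\mathrm{Hom}(W,V)=0=\mathrm{Ext}(W,V)$, where $V=E_1\oplus\cdots\oplus E_{l-1}$. The strand diagram of an exceptional set is the graph on $\{0,1,\dots,n\}$ with an edge (strand) $c(i,j)$, $i<j$, whenever $M_{i,j}$ is isomorphic to an object of the set. If the strand diagram is a tree, root it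 at $0$; a strand $c(i,j)$, $i<j$, is oriented to the right if the path from $0$ to $j$ passes through $i$, and to the left if the path from $0$ to $i$ passes through $j$. The nodes of the associated ternary tree are strands labelled by words in $a,b,c$: the root $R$, with empty label, is the strand $c(0,m)$ with $m$ maximal (if $0$ lies on a strand). If $X=c(i,j)$ is a node oriented to the right, its children, when they exist, are $Xa=c(i,x)$ with $i<x<j$ and $x$ maximal, $Xb=c(y,j)$ with $i<y<j$ and $y$ minimal, and $Xc=c(j,z)$ with $z>j$ maximal. If $X=c(i,j)$ is oriented to the left, they are $Xa=c(x,j)$ with $i<x<j$ and $x$ minimal, $Xb=c(i,y)$ with $i<y<j$ and $y$ maximal, and $Xc=c(z,i)$ with $z<i$ minimal. (Each letter is appended at the end of the label of $X$; the children of $R$, with labels $a,b,c$, are also written $A,B,C$.) Theorem. Let $(E_1,\dots,E_n)$ be an exceptional sequence. Then: 1. The strand diagram of $\{E_1,\dots,E_n\}$ is a tree, and each $E_l$ is isomorphic to $M_{i,j}$ for exactly one pair $i<j$. 2. Each $E_l$ corresponds to exactly one node (label) of the ternary tree, and each node corresponds to exactly one $E_l$. 3. The object $E_l$ corresponding to the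 node with label $w$ is relatively injective if and only if $w$ contains an even number of letters $b$. 4. If $E_l\cong M_{i,j}$ with $i<j$, then $E_l$ is relatively injective if and only if the strand $c(i,j)$ is oriented to the right, i.e. away from the root $0$. -/

import Mathlib

open CategoryTheory CategoryTheory.Limits

universe u

noncomputable section

namespace LinearA

/-! ### Representations of the quiver `1 → 2 → ⋯ → n` -/

/-- The category of finite-dimensional representations over the field `k` of the quiver
`1 → 2 → ⋯ → n` of type `A_n` with straight orientation.  The element `l : Fin n` stands for the
vertex `l + 1`.  There is exactly one path from a vertex to every later one and none to an earlier
one, so the linearly ordered set `Fin n`, seen as a category, is the path category of the quiver,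
and its functors to finite-dimensional vector spaces are the representations. -/
abbrev LinRep (k : Type u) [Field k] (n : ℕ) : Type (u + 1) :=
  Fin n ⥤ FGModuleCat.{u} k

instance hasExt (k : Type u) [Field k] (n : ℕ) : HasExt.{u + 1} (LinRep k n) :=
  HasExt.standard _

/-- The vertex indexed by `l` lies in the interval `(i, j]`, that is, `i < l + 1 ≤ j`. -/
def InSupp {n : ℕ} (i j : Fin (n + 1)) (l : Fin n) : Prop :=
  i.val < l.val + 1 ∧ l.val + 1 ≤ j.val

instance {n : ℕ} (i j : Fin (n + 1)) (l : Fin n) : Decidable (InSupp i j l) :=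
  inferInstanceAs (Decidable (_ ∧ _))

/-- The vector space of `M_{i,j}` at the vertex indexed by `l`: it is `k` (functions on a
one-point type) if the vertex lies in `(i, j]`, and `0` (functions on an empty type) otherwise. -/
abbrev MSpace (k : Type u) {n : ℕ} (i j : Fin (n + 1)) (l : Fin n) : Type u :=
  PLift (InSupp i j l) → k

/-- The structure map of `M_{i,j}`: the identity of `k` if both vertices lie in `(i, j]`, and
`0` otherwise. -/
def mMap (k : Type u) [Field k] {n : ℕ} (i j : Fin (n + 1)) (l m : Fin n) :
    MSpace k i j l →ₗ[k] MSpace k i j m where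
  toFun f := fun _ => if h : InSupp i j l then f ⟨h⟩ else 0
  map_add' f g := by
    funext x
    by_cases h : InSupp i j l <;> simp [h]
  map_smul' c f := by
    funext x
    by_cases h : InSupp i j l <;> simp [h]

/-- The representation `M_{i,j}`, with support `(i, j]`, one-dimensional at each vertex of its
support and with identity maps along the arrows inside the support.
It is meant for `i < j`; otherwise it is zero. -/
def M (k : Type u) [Field k] {n : ℕ} (i j : Fin (n + 1)) : LinRep k n where
  obj l := FGModuleCat.of k (MSpace k i j l)
  map {l m} _ := FGModuleCat.ofHom (mMap k i j l m)
  map_id l := by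
    apply FGModuleCat.hom_ext
    apply LinearMap.ext
    intro f
    funext x
    exact dif_pos x.down
  map_comp {l m p} a b := by
    apply FGModuleCat.hom_ext
    apply LinearMap.ext
    intro f
    funext x
    have hlm : l.val ≤ m.val := leOfHom a
    have hmp : m.val ≤ p.val := leOfHom b
    obtain ⟨hx1, hx2⟩ := x.down
    by_cases h : InSupp i j l
    · have hm : InSupp i j m := ⟨lt_of_lt_of_le h.1 (by omega), by omega⟩
      change (if h : InSupp i j l then f ⟨h⟩ else 0) =
        if h : InSupp i j m then (if h : InSupp i j l then f ⟨h⟩ else 0) else 0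
      rw [dif_pos hm]
    · change (if h : InSupp i j l then f ⟨h⟩ else 0) =
        if h : InSupp i j m then (if h : InSupp i j l then f ⟨h⟩ else 0) else 0
      rw [dif_neg h, dite_eq_ite, ite_self]

/-! ### Exceptional sequences and relative injectivity -/

section Rep

variable {k : Type u} [Field k] {n : ℕ}

/-- `V` is exceptional: its endomorphism ring is a division ring and `Ext^m(V, V) = 0` for all
`m ≥ 1`. -/
structure IsExceptional (V : LinRep k n) : Prop where
  nontrivial : Nontrivial (End V)
  isUnit : ∀ f : End V, f ≠ 0 → IsUnit f
  ext : ∀ m : ℕ, 1 ≤ m → Subsingleton (Abelian.Ext V V m)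

/-- `Hom(V, W) = 0 = Ext^1(V, W)`. -/
def Orth (V W : LinRep k n) : Prop :=
  Subsingleton (V ⟶ W) ∧ Subsingleton (Abelian.Ext V W 1)

/-- `(E_1, …, E_n)` is a complete exceptional sequence; `E l` stands for `E_{l+1}`. -/
structure IsExceptionalSequence (E : Fin n → LinRep k n) : Prop where
  exceptional : ∀ l, IsExceptional (E l)
  orth : ∀ l m, m < l → Orth (E l) (E m)

/-- The left perpendicular category of `V`: the full subcategory of the representations `W` with
`Hom(W, V) = 0 = Ext^1(W, V)`. -/
def leftPerp (V : LinRep k n) : ObjectProperty (LinRep k n) :=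
  fun W => Orth W V

/-- `X` is relatively injective with respect to `V`: it is an injective object of the left
perpendicular category of `V`. -/
def IsRelInjectiveWrt (V X : LinRep k n) : Prop :=
  ∃ h : leftPerp V X, Injective (⟨X, h⟩ : (leftPerp V).FullSubcategory)

instance hasFiniteBiproducts : HasFiniteBiproducts (LinRep k n) :=
  Abelian.hasFiniteBiproducts

/-- The member `E l` of the sequence `E` is relatively injective in it: it is relatively injective
with respect to the direct sum of the members that come before it. -/
def IsRelInjectiveIn (E : Fin n → LinRep k n) (l : Fin n) : Prop :=
  IsRelInjectiveWrt (⨁ fun m : Set.Iio l => E m) (E l)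

/-- The strand diagram of a set `S` of representations: the graph on `{0, …, n}` with an edge
(strand) `c(i,j)`, where `i < j`, whenever `M_{i,j}` belongs to `S` up to isomorphism. -/
def strandDiagram (S : Set (LinRep k n)) : SimpleGraph (Fin (n + 1)) :=
  SimpleGraph.fromRel fun i j => i < j ∧ ∃ X ∈ S, Nonempty (X ≅ M k i j)

end Rep

/-! ### Orientation of the strands and the ternary tree -/

section Strands

variable {n : ℕ}

/-- In the tree `T` with root `0`, the strand `c(i,j)`, where `i < j`, is oriented to the right
(away from the root, from `i` to `j`): the path from `0` to `j` passes through `i`. -/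
def OrientedRight (T : SimpleGraph (Fin (n + 1))) (i j : Fin (n + 1)) : Prop :=
  i < j ∧ T.Adj i j ∧ ∃ p : T.Walk 0 j, p.IsPath ∧ i ∈ p.support

/-- In the tree `T` with root `0`, the strand `c(i,j)`, where `i < j`, is oriented to the left
(away from the root, from `j` to `i`): the path from `0` to `i` passes through `j`. -/
def OrientedLeft (T : SimpleGraph (Fin (n + 1))) (i j : Fin (n + 1)) : Prop :=
  i < j ∧ T.Adj i j ∧ ∃ p : T.Walk 0 i, p.IsPath ∧ j ∈ p.support

/-- The letters used in the labels of the nodes. -/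
inductive Letter
  | a
  | b
  | c
  deriving DecidableEq

/-- `IsNode T w i j`: the node with label `w` exists in the ternary tree of the strand diagram `T`
and is the strand `c(i,j)`, where `i < j`.

A label is a word in the letters `a`, `b`, `c`.  The root `R` has the empty label, its children
`A`, `B`, `C` have the labels `a`, `b`, `c`, and the children `Xa`, `Xb`, `Xc` of a node `X` are
labelled by appending the letter at the end. -/
inductive IsNode (T : SimpleGraph (Fin (n + 1))) :
    List Letter → Fin (n + 1) → Fin (n + 1) → Prop
  | root {m : Fin (n + 1)} : IsGreatest {m | T.Adj 0 m} m → IsNode T [] 0 m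
  | right_a {w : List Letter} {i j x : Fin (n + 1)} : IsNode T w i j → OrientedRight T i j →
      IsGreatest {x | i < x ∧ x < j ∧ T.Adj i x} x → IsNode T (w ++ [Letter.a]) i x
  | right_b {w : List Letter} {i j y : Fin (n + 1)} : IsNode T w i j → OrientedRight T i j →
      IsLeast {y | i < y ∧ y < j ∧ T.Adj y j} y → IsNode T (w ++ [Letter.b]) y j
  | right_c {w : List Letter} {i j z : Fin (n + 1)} : IsNode T w i j → OrientedRight T i j →
      IsGreatest {z | j < z ∧ T.Adj j z} z → IsNode T (w ++ [Letter.c]) j z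
  | left_a {w : List Letter} {i j x : Fin (n + 1)} : IsNode T w i j → OrientedLeft T i j →
      IsLeast {x | i < x ∧ x < j ∧ T.Adj x j} x → IsNode T (w ++ [Letter.a]) x j
  | left_b {w : List Letter} {i j y : Fin (n + 1)} : IsNode T w i j → OrientedLeft T i j →
      IsGreatest {y | i < y ∧ y < j ∧ T.Adj i y} y → IsNode T (w ++ [Letter.b]) i y
  | left_c {w : List Letter} {i j z : Fin (n + 1)} : IsNode T w i j → OrientedLeft T i j →
      IsLeast {z | z < i ∧ T.Adj z i} z → IsNode T (w ++ [Letter.c]) z i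

/-- The node with label `w` exists in the ternary tree of the set `S` and corresponds to `X`. -/
def NodeOf {k : Type u} [Field k] (S : Set (LinRep k n)) (w : List Letter) (X : LinRep k n) :
    Prop :=
  ∃ i j : Fin (n + 1), IsNode (strandDiagram S) w i j ∧ Nonempty (X ≅ M k i j)

end Strands

end LinearA

end

/-! The proof turns orthogonality into bijectivity of structure maps and then into combinatorics of
intervals. An exceptional representation has some `M k p q` as a retract, hence equals it up to
isomorphism because its endomorphism ring is a division ring (`exists_iso_M_of_isExceptional`). With
the convention that a representation `X` vanishes at the vertex `0` and beyond `n`, morphisms `X ⟶ M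
k r s` are the linear forms on `X_s` that kill the image of `X_r`. The injective resolution `0 →
M_{r,s} → M_{0,s} → M_{0,r} → 0` identifies the vanishing of `Ext` with injectivity of `X_r → X_s`.
So `Orth X (M k r s)` means that `X_r → X_s` is bijective (`orth_M_iff`), and an exceptional
sequence becomes a list of intervals in which each later one contains both or neither of the ends of
each earlier one (`IsExcPairs`).

The differences of dimensions along the strands are linear forms that are unitriangular on the
dimension vectors, so these vectors form a basis of `ℚ^n`. Hence a function on the vertices that is
constant along every strand is constant, the diagram is connected, and counting its `n` edges makes
it a tree. Crossing strands would contradict `IsExcPairs` directly.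

For a noncrossing rooted tree the labels are pure combinatorics. The parent of a strand is the next
longer strand on the same side of its end nearer to the root or, failing that, the strand entering
that end. This gives existence (`exists_isNode`) and uniqueness (`IsNode.label_unique`) of labels,
and the orientation switches exactly at a letter `b` (`IsNode.orientation`).

It remains to compare relative injectivity with orientation
(`IsExceptionalSequence.isRelInjectiveIn_iff`). If strand `l` points right, a failure of injectivity
of the map from `a l` to `b l` on the perpendicular category yields a summand `M_{p,q}` with `p < a
l ≤ q < b l`. Its coefficient at `E l` is `-1`, which forces `p` to be a descendant of `b l`, beyond
the nondescendant `a l`; noncrossing forbids this. If strand `l` points left, some `M_{p, b l}` with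
`p < a l` is perpendicular, and `M_{a l, b l}` embeds in it without splitting. -/

noncomputable section

namespace LinearA

/-! ### Representations as families of vector spaces with compatible linear maps -/

section Rep

variable {k : Type u} [Field k] {n : ℕ}

/-- The structure map of a representation between two vertices, as a linear map. -/
def trans (X : LinRep k n) {l m : Fin n} (h : l ≤ m) : X.obj l →ₗ[k] X.obj m :=
  (X.map (homOfLE h)).hom.hom

/-- The component of a morphism of representations at a vertex, as a linear map. -/
def vertexMap {X Y : LinRep k n} (f : X ⟶ Y) (l : Fin n) : X.obj l →ₗ[k] Y.obj l :=
  (f.app l).hom.hom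

lemma trans_refl (X : LinRep k n) (l : Fin n) (x : X.obj l) : trans X le_rfl x = x := by
  simp [trans]

lemma trans_trans (X : LinRep k n) {l m p : Fin n} (h : l ≤ m) (h' : m ≤ p) (x : X.obj l) :
    trans X h' (trans X h x) = trans X (h.trans h') x := by
  have : X.map (homOfLE (h.trans h')) = X.map (homOfLE h) ≫ X.map (homOfLE h') := by
    rw [← X.map_comp]; rfl
  simp [trans, this]

lemma vertexMap_trans {X Y : LinRep k n} (f : X ⟶ Y) {l m : Fin n} (h : l ≤ m) (x : X.obj l) :
    vertexMap f m (trans X h x) = trans Y h (vertexMap f l x) := by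
  have := f.naturality (homOfLE h)
  have := congrArg (fun g => g.hom.hom x) this
  exact this

lemma rep_hom_ext {X Y : LinRep k n} {f g : X ⟶ Y} (h : ∀ l x, vertexMap f l x = vertexMap g l x) :
    f = g := by
  ext l : 2
  apply FGModuleCat.hom_ext
  ext x
  exact h l x

/-- A morphism of representations from compatible linear maps. -/
def mkHom {X Y : LinRep k n} (f : ∀ l, X.obj l →ₗ[k] Y.obj l)
    (hf : ∀ {l m : Fin n} (h : l ≤ m) (x : X.obj l), f m (trans X h x) = trans Y h (f l x)) :
    X ⟶ Y where
  app l := FGModuleCat.ofHom (f l)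
  naturality l m h := by
    apply FGModuleCat.hom_ext
    ext x
    exact hf (leOfHom h) x

/-- A representation from vector spaces and compatible linear maps. -/
def mkRep (V : Fin n → Type u) [∀ l, AddCommGroup (V l)] [∀ l, Module k (V l)]
    [∀ l, Module.Finite k (V l)] (t : ∀ {l m : Fin n}, l ≤ m → (V l →ₗ[k] V m))
    (t_refl : ∀ l x, t (le_refl l) x = x)
    (t_trans : ∀ {l m p} (h : l ≤ m) (h' : m ≤ p) x, t h' (t h x) = t (h.trans h') x) :
    LinRep k n where
  obj l := FGModuleCat.of k (V l)
  map h := FGModuleCat.ofHom (t (leOfHom h))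
  map_id l := by
    apply FGModuleCat.hom_ext
    ext x
    exact t_refl l x
  map_comp h h' := by
    apply FGModuleCat.hom_ext
    ext x
    exact (t_trans (leOfHom h) (leOfHom h') x).symm

/-- The subrepresentation given by a stable family of subspaces. -/
def subRep (X : LinRep k n) (N : ∀ l, Submodule k (X.obj l))
    (hN : ∀ {l m : Fin n} (h : l ≤ m), ∀ x ∈ N l, trans X h x ∈ N m) : LinRep k n :=
  mkRep (fun l => N l) (fun h => (trans X h).restrict (hN h))
    (fun l x => Subtype.ext (trans_refl X l x))
    (fun h h' x => Subtype.ext (trans_trans X h h' x))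

/-- The inclusion of a subrepresentation. -/
def subRepι (X : LinRep k n) (N : ∀ l, Submodule k (X.obj l))
    (hN : ∀ {l m : Fin n} (h : l ≤ m), ∀ x ∈ N l, trans X h x ∈ N m) : subRep X N hN ⟶ X :=
  mkHom (X := subRep X N hN) (fun l => (N l).subtype) (fun _ _ => rfl)

/-- The quotient representation given by a stable family of subspaces. -/
def quotRep (X : LinRep k n) (N : ∀ l, Submodule k (X.obj l))
    (hN : ∀ {l m : Fin n} (h : l ≤ m), ∀ x ∈ N l, trans X h x ∈ N m) : LinRep k n :=
  mkRep (fun l => X.obj l ⧸ N l) (fun {l m} h => (N l).mapQ (N m) (trans X h) (hN h))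
    (fun l x => by
      obtain ⟨x, rfl⟩ := (N l).mkQ_surjective x
      simp [trans_refl])
    (fun {l m p} h h' x => by
      obtain ⟨x, rfl⟩ := (N l).mkQ_surjective x
      simp [trans_trans])

/-- The projection to a quotient representation. -/
def quotRepπ (X : LinRep k n) (N : ∀ l, Submodule k (X.obj l))
    (hN : ∀ {l m : Fin n} (h : l ≤ m), ∀ x ∈ N l, trans X h x ∈ N m) : X ⟶ quotRep X N hN :=
  mkHom (Y := quotRep X N hN) (fun l => (N l).mkQ) (fun _ _ => rfl)

/-! ### Extension of a representation by zero to all natural numbers -/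

/-- The vector space of `X` at the vertex `v`; it is zero unless `1 ≤ v ≤ n`. -/
abbrev Bar (X : LinRep k n) (v : ℕ) : Type u :=
  ∀ h : PLift (1 ≤ v ∧ v ≤ n), X.obj ⟨v - 1, by have := h.down; omega⟩

/-- The structure map of `X` between two vertices. -/
def tr (X : LinRep k n) {v w : ℕ} (h : v ≤ w) : Bar X v →ₗ[k] Bar X w where
  toFun x := fun hw => if hv : 1 ≤ v ∧ v ≤ n then
    trans X (show (⟨v - 1, by omega⟩ : Fin n) ≤ ⟨w - 1, _⟩ by
      simp only [Fin.mk_le_mk]; omega) (x ⟨hv⟩) else 0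
  map_add' x y := by
    funext hw
    by_cases hv : 1 ≤ v ∧ v ≤ n <;> simp [hv]
  map_smul' c x := by
    funext hw
    by_cases hv : 1 ≤ v ∧ v ≤ n <;> simp [hv]

lemma tr_refl (X : LinRep k n) (v : ℕ) (x : Bar X v) : tr X (le_refl v) x = x := by
  funext h
  simp [tr, h.down, trans_refl]

lemma tr_tr (X : LinRep k n) {v w z : ℕ} (h : v ≤ w) (h' : w ≤ z) (x : Bar X v) :
    tr X h' (tr X h x) = tr X (h.trans h') x := by
  funext hz
  have := hz.down
  by_cases hv : 1 ≤ v ∧ v ≤ n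
  · have hw : 1 ≤ w ∧ w ≤ n := by omega
    simp [tr, hv, hw, trans_trans]
  · simp [tr, hv]

/-- The component of a morphism at a vertex. -/
def barMap {X Y : LinRep k n} (f : X ⟶ Y) (v : ℕ) : Bar X v →ₗ[k] Bar Y v where
  toFun x := fun h => vertexMap f _ (x h)
  map_add' x y := by funext h; simp
  map_smul' c x := by funext h; simp

lemma barMap_tr {X Y : LinRep k n} (f : X ⟶ Y) {v w : ℕ} (h : v ≤ w) (x : Bar X v) :
    barMap f w (tr X h x) = tr Y h (barMap f v x) := by
  funext hw
  by_cases hv : 1 ≤ v ∧ v ≤ n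
  · simp [tr, barMap, hv, vertexMap_trans]
  · simp [tr, barMap, hv]

@[simp] lemma barMap_comp {X Y Z : LinRep k n} (f : X ⟶ Y) (g : Y ⟶ Z) (v : ℕ) (x : Bar X v) :
    barMap (f ≫ g) v x = barMap g v (barMap f v x) := rfl

@[simp] lemma barMap_id (X : LinRep k n) (v : ℕ) (x : Bar X v) : barMap (𝟙 X) v x = x := rfl

@[simp] lemma barMap_zero (X Y : LinRep k n) (v : ℕ) (x : Bar X v) :
    barMap (0 : X ⟶ Y) v x = 0 := rfl

/-- An element of the vector space at the vertex indexed by `l`. -/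
def toBar (X : LinRep k n) (l : Fin n) : X.obj l →ₗ[k] Bar X (l.val + 1) where
  toFun x := fun _ => x
  map_add' _ _ := rfl
  map_smul' _ _ := rfl

/-- The inverse of `toBar`. -/
def ofBar (X : LinRep k n) (l : Fin n) : Bar X (l.val + 1) →ₗ[k] X.obj l where
  toFun x := x ⟨by have := l.isLt; omega⟩
  map_add' _ _ := rfl
  map_smul' _ _ := rfl

@[simp] lemma ofBar_toBar (X : LinRep k n) (l : Fin n) (x : X.obj l) :
    ofBar X l (toBar X l x) = x := rfl

@[simp] lemma toBar_ofBar (X : LinRep k n) (l : Fin n) (x : Bar X (l.val + 1)) :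
    toBar X l (ofBar X l x) = x := rfl

lemma tr_toBar (X : LinRep k n) {l m : Fin n} (h : l ≤ m) (x : X.obj l) :
    tr X (Nat.succ_le_succ h) (toBar X l x) = toBar X m (trans X h x) := by
  funext hw
  have : 1 ≤ l.val + 1 ∧ l.val + 1 ≤ n := by have := l.isLt; omega
  exact dif_pos this

lemma bar_eq_zero (X : LinRep k n) {v : ℕ} (hv : ¬(1 ≤ v ∧ v ≤ n)) (x : Bar X v) : x = 0 := by
  funext h
  exact absurd h.down hv

lemma rep_hom_ext_bar {X Y : LinRep k n} {f g : X ⟶ Y} (h : ∀ v x, barMap f v x = barMap g v x) :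
    f = g := by
  refine rep_hom_ext fun l x => ?_
  have := congrArg (ofBar Y l) (h _ (toBar X l x))
  exact this

/-! ### Interval representations -/

lemma trans_M {p q : Fin (n + 1)} {l m : Fin n} (h : l ≤ m) (x : (M k p q).obj l)
    (hl : InSupp p q l) (hm : InSupp p q m) :
    trans (M k p q) h x ⟨hm⟩ = x ⟨hl⟩ :=
  dif_pos hl

/-- The coordinate of `M_{p,q}` at a vertex of its support. -/
def coord (p q : Fin (n + 1)) {v : ℕ} (h : p.val < v ∧ v ≤ q.val) : Bar (M k p q) v →ₗ[k] k where
  toFun x := x ⟨by have := q.isLt; omega⟩ ⟨by simp only [InSupp]; omega⟩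
  map_add' _ _ := rfl
  map_smul' _ _ := rfl

/-- The element of `M_{p,q}` with constant coordinate. -/
def constBar (p q : Fin (n + 1)) (v : ℕ) (c : k) : Bar (M k p q) v :=
  fun _ => (fun _ => c : MSpace k p q _)

@[simp] lemma coord_constBar (p q : Fin (n + 1)) {v : ℕ} (h : p.val < v ∧ v ≤ q.val) (c : k) :
    coord p q h (constBar p q v c) = c := rfl

lemma barM_ext {p q : Fin (n + 1)} {v : ℕ} {x y : Bar (M k p q) v}
    (hxy : ∀ h, coord p q h x = coord p q h y) : x = y := by
  funext h
  refine funext (α := PLift _) fun h' => ?_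
  have h1 := h.down
  have h2 := h'.down
  simp only [InSupp] at h2
  exact hxy ⟨by omega, by omega⟩

lemma barM_eq_zero {p q : Fin (n + 1)} {v : ℕ} (h : ¬(p.val < v ∧ v ≤ q.val))
    (x : Bar (M k p q) v) : x = 0 :=
  barM_ext fun h' => absurd h' h

lemma coord_tr {p q : Fin (n + 1)} {v w : ℕ} (h : v ≤ w) (hv : p.val < v ∧ v ≤ q.val)
    (hw : p.val < w ∧ w ≤ q.val) (x : Bar (M k p q) v) :
    coord p q hw (tr (M k p q) h x) = coord p q hv x := by
  have hn : 1 ≤ v ∧ v ≤ n := by have := q.isLt; omega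
  have hs : InSupp p q (⟨v - 1, by omega⟩ : Fin n) := by simp only [InSupp]; omega
  have hs' : InSupp p q (⟨w - 1, by have := q.isLt; omega⟩ : Fin n) := by
    simp only [InSupp]; omega
  simp only [coord, tr, LinearMap.coe_mk, AddHom.coe_mk, dif_pos hn]
  exact trans_M (show (⟨v - 1, _⟩ : Fin n) ≤ ⟨w - 1, _⟩ by
    simp only [Fin.mk_le_mk]; omega) _ hs hs'

/-- The structure map of `M_{p,q}` from `r` to `s` is bijective if and only if both vertices or
none of them lie in `(p, q]`. -/
lemma bijective_tr_M_iff (p q : Fin (n + 1)) {r s : ℕ} (h : r ≤ s) :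
    Function.Bijective (tr (M k p q) h) ↔
      ((p.val < r ∧ r ≤ q.val) ↔ (p.val < s ∧ s ≤ q.val)) := by
  constructor
  · intro hb
    constructor
    · intro hr
      by_contra hs
      have h1 : tr (M k p q) h (constBar p q r 1) = tr (M k p q) h 0 := by
        rw [barM_eq_zero hs (tr (M k p q) h (constBar p q r 1)), map_zero]
      have := congrArg (coord p q hr) (hb.1 h1)
      simp at this
    · intro hs
      by_contra hr
      obtain ⟨x, hx⟩ := hb.2 (constBar p q s 1)
      rw [barM_eq_zero hr x, map_zero] at hx
      have := congrArg (coord p q hs) hx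
      simp at this
  · intro hrs
    by_cases hr : p.val < r ∧ r ≤ q.val
    · have hs := hrs.1 hr
      constructor
      · intro x y hxy
        refine barM_ext fun _ => ?_
        have := congrArg (coord p q hs) hxy
        rwa [coord_tr h hr hs, coord_tr h hr hs] at this
      · intro y
        refine ⟨constBar p q r (coord p q hs y), barM_ext fun _ => ?_⟩
        rw [coord_tr h hr hs, coord_constBar]
    · have hs : ¬(p.val < s ∧ s ≤ q.val) := fun hs => hr (hrs.2 hs)
      exact ⟨fun x y _ => (barM_eq_zero hr x).trans (barM_eq_zero hr y).symm,
        fun y => ⟨0, (barM_eq_zero hs _).trans (barM_eq_zero hs y).symm⟩⟩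

/-- The morphism to `M_{p,q}` given by a linear form at `q` that vanishes on the image of the
vector space at `p`. -/
def toM (X : LinRep k n) {p q : Fin (n + 1)} (hpq : p ≤ q) (φ : Bar X q.val →ₗ[k] k)
    (hφ : ∀ x, φ (tr X hpq x) = 0) : X ⟶ M k p q :=
  mkHom (Y := M k p q) (fun l =>
    { toFun := fun x => fun h => φ (tr X h.down.2 (toBar X l x))
      map_add' := fun x y => by funext h; simp; rfl
      map_smul' := fun c x => by funext h; simp; rfl }) (by
    intro l m h x
    refine funext (α := PLift _) fun hm => ?_
    have hm2 := hm.down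
    simp only [InSupp] at hm2
    have hlm : l.val ≤ m.val := h
    change φ (tr X hm2.2 (toBar X m (trans X h x))) = _
    rw [← tr_toBar, tr_tr]
    by_cases hl : InSupp p q l
    · symm
      exact dif_pos hl
    · have hlp : l.val + 1 ≤ p.val := by simp only [InSupp] at hl; omega
      have h1 := hφ (tr X hlp (toBar X l x))
      rw [tr_tr] at h1
      rw [h1]
      symm
      exact dif_neg hl)

lemma coord_toM (X : LinRep k n) {p q : Fin (n + 1)} (hpq : p ≤ q) (φ : Bar X q.val →ₗ[k] k)
    (hφ : ∀ x, φ (tr X hpq x) = 0) {v : ℕ} (hv : p.val < v ∧ v ≤ q.val) (x : Bar X v) :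
    coord p q hv (barMap (toM X hpq φ hφ) v x) = φ (tr X hv.2 x) := by
  obtain ⟨v, rfl⟩ : ∃ w, v = w + 1 := ⟨v - 1, by omega⟩
  have hvn : v < n := by have := q.isLt; omega
  obtain ⟨x, rfl⟩ : ∃ y, x = toBar X ⟨v, hvn⟩ y := ⟨ofBar X ⟨v, hvn⟩ x, rfl⟩
  rfl

/-- The linear form at `q` that belongs to a morphism to `M_{p,q}`. -/
def formOf {X : LinRep k n} {p q : Fin (n + 1)} (hpq : p < q) (f : X ⟶ M k p q) :
    Bar X q.val →ₗ[k] k :=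
  (coord p q ⟨hpq, le_rfl⟩).comp (barMap f q.val)

lemma formOf_apply {X : LinRep k n} {p q : Fin (n + 1)} (hpq : p < q) (f : X ⟶ M k p q)
    (x : Bar X q.val) : formOf hpq f x = coord p q ⟨hpq, le_rfl⟩ (barMap f q.val x) := rfl

lemma formOf_tr {X : LinRep k n} {p q : Fin (n + 1)} (hpq : p < q) (f : X ⟶ M k p q)
    (x : Bar X p.val) : formOf hpq f (tr X hpq.le x) = 0 := by
  rw [formOf_apply, barMap_tr, barM_eq_zero (by omega) (barMap f p.val x), map_zero, map_zero]

lemma formOf_toM (X : LinRep k n) {p q : Fin (n + 1)} (hpq : p < q) (φ : Bar X q.val →ₗ[k] k)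
    (hφ : ∀ x, φ (tr X hpq.le x) = 0) : formOf hpq (toM X hpq.le φ hφ) = φ := by
  refine LinearMap.ext fun x => ?_
  rw [formOf_apply, coord_toM, tr_refl]

lemma hom_M_ext {X : LinRep k n} {p q : Fin (n + 1)} (hpq : p < q) {f g : X ⟶ M k p q}
    (h : formOf hpq f = formOf hpq g) : f = g := by
  refine rep_hom_ext_bar fun v x => barM_ext fun hv => ?_
  have h1 := LinearMap.congr_fun h (tr X hv.2 x)
  simp only [formOf_apply, barMap_tr] at h1
  rwa [coord_tr _ hv, coord_tr _ hv] at h1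

lemma formOf_comp {X Y : LinRep k n} {p q : Fin (n + 1)} (hpq : p < q) (f : X ⟶ Y)
    (g : Y ⟶ M k p q) : formOf hpq (f ≫ g) = (formOf hpq g).comp (barMap f q.val) := rfl

lemma formOf_zero {X : LinRep k n} {p q : Fin (n + 1)} (hpq : p < q) :
    formOf hpq (0 : X ⟶ M k p q) = 0 := rfl

lemma hom_M_eq_zero {X : LinRep k n} {p q : Fin (n + 1)} (hpq : ¬ p < q) (f : X ⟶ M k p q) :
    f = 0 :=
  rep_hom_ext_bar fun _ _ => barM_ext fun hv => absurd (lt_of_lt_of_le hv.1 hv.2) hpq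

/-- `Hom(X, M_{r,s}) = 0` if and only if the structure map of `X` from `r` to `s` is
surjective. -/
lemma subsingleton_hom_M_iff (X : LinRep k n) {r s : Fin (n + 1)} (h : r < s) :
    Subsingleton (X ⟶ M k r s) ↔ Function.Surjective (tr X (show r.val ≤ s.val from h.le)) := by
  constructor
  · intro hs
    rw [← LinearMap.range_eq_top]
    by_contra hne
    obtain ⟨φ, hφ, hle⟩ := Submodule.exists_le_ker_of_lt_top _ (lt_top_iff_ne_top.2 hne)
    have hφ' : ∀ x, φ (tr X h.le x) = 0 := fun x => hle ⟨x, rfl⟩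
    apply hφ
    rw [← formOf_toM X h φ hφ', Subsingleton.elim (toM X h.le φ hφ') 0, formOf_zero]
  · intro hs
    refine ⟨fun f g => hom_M_ext h ?_⟩
    refine LinearMap.ext fun x => ?_
    obtain ⟨y, rfl⟩ := hs x
    rw [formOf_tr, formOf_tr]

/-- The morphism from `M_{p,q}` given by an element at `p + 1` that vanishes at `q + 1`. -/
def fromM (X : LinRep k n) {p q : Fin (n + 1)} (hpq : p ≤ q) (v : Bar X (p.val + 1))
    (hv : tr X (Nat.succ_le_succ hpq) v = 0) : M k p q ⟶ X :=
  mkHom (X := M k p q) (fun l =>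
    { toFun := fun f => if h : InSupp p q l then f ⟨h⟩ • ofBar X l (tr X (Nat.succ_le_of_lt h.1) v)
        else 0
      map_add' := fun x y => by
        by_cases h : InSupp p q l
        · simp only [dif_pos h]; exact add_smul _ _ _
        · simp [h]
      map_smul' := fun c x => by
        by_cases h : InSupp p q l
        · simp only [dif_pos h]; exact mul_smul _ _ _
        · simp [h] }) (by
    intro l m h x
    simp only [LinearMap.coe_mk, AddHom.coe_mk]
    have hlm : l.val ≤ m.val := h
    by_cases hl : InSupp p q l
    · have hl2 := hl
      simp only [InSupp] at hl2
      have key : trans X h (ofBar X l (tr X (Nat.succ_le_of_lt hl.1) v)) =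
          ofBar X m (tr X (show p.val + 1 ≤ m.val + 1 by omega) v) := by
        have := tr_toBar X h (ofBar X l (tr X (Nat.succ_le_of_lt hl.1) v))
        rw [toBar_ofBar, tr_tr] at this
        rw [this, ofBar_toBar]
      by_cases hm : InSupp p q m
      · rw [dif_pos hm, dif_pos hl, map_smul, trans_M h x hl hm, key]
      · rw [dif_neg hm, dif_pos hl, map_smul, key]
        simp only [InSupp] at hm
        rw [← tr_tr X (Nat.succ_le_succ hpq) (show q.val + 1 ≤ m.val + 1 by omega), hv]
        simp
    · rw [dif_neg hl, map_zero]
      by_cases hm : InSupp p q m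
      · rw [dif_pos hm]
        have : trans (M k p q) h x ⟨hm⟩ = 0 := dif_neg hl
        rw [this, zero_smul]
      · rw [dif_neg hm])

lemma barMap_fromM (X : LinRep k n) {p q : Fin (n + 1)} (hpq : p ≤ q) (v : Bar X (p.val + 1))
    (hv : tr X (Nat.succ_le_succ hpq) v = 0) {w : ℕ} (hw : p.val < w ∧ w ≤ q.val)
    (x : Bar (M k p q) w) :
    barMap (fromM X hpq v hv) w x = coord p q hw x • tr X (Nat.succ_le_of_lt hw.1) v := by
  obtain ⟨w, rfl⟩ : ∃ w', w = w' + 1 := ⟨w - 1, by omega⟩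
  funext h
  have : InSupp p q (⟨w, by have := q.isLt; omega⟩ : Fin n) := by simp only [InSupp]; omega
  exact dif_pos this

/-- An element at `p + 1` that vanishes at `q + 1` and a linear form at `q` that vanishes on the
image of the vector space at `p` make `M_{p,q}` a retract if they pair to `1`. -/
lemma fromM_toM (X : LinRep k n) {p q : Fin (n + 1)} (hpq : p < q) (v : Bar X (p.val + 1))
    (hv : tr X (Nat.succ_le_succ hpq.le) v = 0) (φ : Bar X q.val →ₗ[k] k)
    (hφ : ∀ x, φ (tr X hpq.le x) = 0) (h1 : φ (tr X (Nat.succ_le_of_lt hpq) v) = 1) :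
    fromM X hpq.le v hv ≫ toM X hpq.le φ hφ = 𝟙 (M k p q) := by
  refine hom_M_ext hpq ?_
  refine LinearMap.ext fun x => ?_
  rw [formOf_comp, LinearMap.comp_apply, formOf_toM, barMap_fromM X hpq.le v hv ⟨hpq, le_rfl⟩,
    map_smul, h1, formOf_apply, barMap_id, smul_eq_mul, mul_one]

/-- If a vector at `p + 1` vanishes at `q + 1` and its image at `q` is not in the image of the
vector space at `p`, then `M_{p,q}` is a retract. -/
lemma exists_retract (X : LinRep k n) {p q : Fin (n + 1)} (hpq : p < q) (v : Bar X (p.val + 1))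
    (hv : tr X (Nat.succ_le_succ hpq.le) v = 0)
    (h : ∀ y, tr X hpq.le y ≠ tr X (Nat.succ_le_of_lt hpq) v) :
    ∃ (i : M k p q ⟶ X) (r : X ⟶ M k p q), i ≫ r = 𝟙 (M k p q) := by
  obtain ⟨φ, hφ, hle⟩ := Submodule.exists_le_ker_of_notMem
    (p := LinearMap.range (tr X hpq.le)) (v := tr X (Nat.succ_le_of_lt hpq) v)
    (by rintro ⟨y, hy⟩; exact h y hy)
  set c := φ (tr X (Nat.succ_le_of_lt hpq) v) with hc
  exact ⟨_, _, fromM_toM X hpq v hv (c⁻¹ • φ)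
    (fun x => by
      have : φ (tr X hpq.le x) = 0 := hle ⟨x, rfl⟩
      simp [this])
    (by simp [← hc, inv_mul_cancel₀ hφ])⟩

lemma barMap_bijective_of_iso {X Y : LinRep k n} (e : X ≅ Y) (v : ℕ) :
    Function.Bijective (barMap e.hom v) := by
  refine Function.bijective_iff_has_inverse.2 ⟨barMap e.inv v, fun x => ?_, fun x => ?_⟩
  · rw [← barMap_comp, e.hom_inv_id, barMap_id]
  · rw [← barMap_comp, e.inv_hom_id, barMap_id]

/-- An interval representation determines its interval. -/
lemma interval_eq_of_iso {p q r s : Fin (n + 1)} (hpq : p < q) (hrs : r < s)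
    (e : M k p q ≅ M k r s) : p = r ∧ q = s := by
  have key : ∀ v : ℕ, (p.val < v ∧ v ≤ q.val) ↔ (r.val < v ∧ v ≤ s.val) := by
    intro v
    have hb := barMap_bijective_of_iso e v
    constructor
    · intro h
      by_contra h'
      have h1 : barMap e.hom v (constBar p q v 1) = barMap e.hom v 0 :=
        (barM_eq_zero h' _).trans (barM_eq_zero h' _).symm
      have := congrArg (coord p q h) (hb.1 h1)
      simp at this
    · intro h
      by_contra h'
      obtain ⟨x, hx⟩ := hb.2 (constBar r s v 1)
      rw [barM_eq_zero h' x, map_zero] at hx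
      have := congrArg (coord r s h) hx
      simp at this
  have h1 := (key (p.val + 1)).1
  have h2 := (key (r.val + 1)).2
  have h3 := (key q.val).1
  have h4 := (key s.val).2
  constructor <;> apply Fin.ext <;> omega

/-- A representation whose endomorphism ring is a division ring is an interval representation. -/
lemma exists_iso_M_of_isExceptional {X : LinRep k n} (hX : IsExceptional X) :
    ∃ p q : Fin (n + 1), p < q ∧ Nonempty (X ≅ M k p q) := by
  have hex : ∃ v : ℕ, ∃ x : Bar X v, x ≠ 0 := by
    by_contra hcon
    push Not at hcon
    have := hX.nontrivial
    obtain ⟨f, g, hfg⟩ := exists_pair_ne (End X)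
    exact hfg (rep_hom_ext_bar (f := f) (g := g) fun v x => by rw [hcon v x, map_zero, map_zero])
  classical
  obtain ⟨x, hx⟩ := Nat.find_spec hex
  have hmin := fun v hv => Nat.find_min hex (m := v) hv
  generalize Nat.find hex = v at x hx hmin
  have hv : 1 ≤ v ∧ v ≤ n := by
    by_contra h
    exact hx (bar_eq_zero X h x)
  obtain ⟨v, rfl⟩ : ∃ p, v = p + 1 := ⟨v - 1, by omega⟩
  -- The vector `x` starts at the first nonzero vertex `v + 1` and dies at `n + 1` at the latest;
  -- the least `q` such that it is zero at `q + 1` is the right end of the interval.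
  have hex2 : ∃ q : ℕ, ∃ h : v + 1 ≤ q + 1, tr X h x = 0 :=
    ⟨n, by omega, bar_eq_zero X (by omega) _⟩
  obtain ⟨hvq, hq0⟩ := Nat.find_spec hex2
  have hmin2 := fun q hq => Nat.find_min hex2 (m := q) hq
  have hle : Nat.find hex2 ≤ n := Nat.find_min' hex2 ⟨by omega, bar_eq_zero X (by omega) _⟩
  generalize Nat.find hex2 = q at hvq hq0 hmin2 hle
  have hne : v ≠ q := by
    rintro rfl
    rw [tr_refl] at hq0
    exact hx hq0
  have hlt : v < q := by omega
  have hq1 : tr X (show v + 1 ≤ q by omega) x ≠ 0 := by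
    intro h0
    obtain ⟨q, rfl⟩ : ∃ q', q = q' + 1 := ⟨q - 1, by omega⟩
    exact hmin2 q (by omega) ⟨by omega, h0⟩
  have hv0 : ∀ y : Bar X v, y = 0 := by
    intro y
    by_contra hy
    exact hmin v (by omega) ⟨y, hy⟩
  obtain ⟨i, r, hir⟩ := exists_retract X (p := ⟨v, by omega⟩) (q := ⟨q, by omega⟩) hlt x hq0
    (fun y => by rw [hv0 y, map_zero]; exact hq1.symm)
  refine ⟨_, _, hlt, ⟨⟨r, i, ?_, hir⟩⟩⟩
  have hne0 : (r ≫ i : End X) ≠ 0 := by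
    intro h0
    have h1 : i ≫ (r ≫ i) ≫ r = 0 := by
      have : (r ≫ i : X ⟶ X) = 0 := h0
      rw [this]; simp
    rw [Category.assoc, hir, Category.comp_id, hir] at h1
    have h2 := congrArg (fun f => formOf (Fin.mk_lt_mk.2 hlt) f (constBar _ _ _ 1)) h1
    rw [formOf_apply, barMap_id, coord_constBar] at h2
    exact one_ne_zero h2
  have hu := hX.isUnit _ hne0
  -- A nonzero idempotent of a division ring is the identity, so the retraction is an isomorphism.
  let e : End X := r ≫ i
  have he : e * e = e * 1 := by
    rw [mul_one]
    change (r ≫ i) ≫ (r ≫ i) = r ≫ i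
    rw [Category.assoc, ← Category.assoc i, hir, Category.id_comp]
  exact IsUnit.mul_left_cancel (M := End X) hu he

/-! ### Kernels and cokernels -/

lemma trans_mem_ker {X Y : LinRep k n} (f : X ⟶ Y) {l m : Fin n} (h : l ≤ m) :
    ∀ x ∈ LinearMap.ker (vertexMap f l), trans X h x ∈ LinearMap.ker (vertexMap f m) := fun x hx => by
  rw [LinearMap.mem_ker] at hx ⊢
  rw [vertexMap_trans, hx, map_zero]

lemma trans_mem_range {X Y : LinRep k n} (f : X ⟶ Y) {l m : Fin n} (h : l ≤ m) :
    ∀ x ∈ LinearMap.range (vertexMap f l), trans Y h x ∈ LinearMap.range (vertexMap f m) := by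
  rintro _ ⟨y, rfl⟩
  exact ⟨trans X h y, vertexMap_trans f h y⟩

/-- The kernel of a morphism of representations. -/
def kerRep {X Y : LinRep k n} (f : X ⟶ Y) : LinRep k n :=
  subRep X (fun l => LinearMap.ker (vertexMap f l)) (trans_mem_ker f)

/-- The inclusion of the kernel of a morphism of representations. -/
def kerRepι {X Y : LinRep k n} (f : X ⟶ Y) : kerRep f ⟶ X :=
  subRepι X _ (trans_mem_ker f)

lemma kerRepι_comp {X Y : LinRep k n} (f : X ⟶ Y) : kerRepι f ≫ f = 0 :=
  rep_hom_ext fun _ x => LinearMap.mem_ker.1 x.2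

lemma barMap_kerRepι_injective {X Y : LinRep k n} (f : X ⟶ Y) (v : ℕ) :
    Function.Injective (barMap (kerRepι f) v) := fun x y h => by
  funext hv
  exact Subtype.ext (congrFun h hv)

lemma exists_barMap_kerRepι {X Y : LinRep k n} (f : X ⟶ Y) {v : ℕ} {x : Bar X v}
    (hx : barMap f v x = 0) : ∃ y, barMap (kerRepι f) v y = x :=
  ⟨fun hv => ⟨x hv, LinearMap.mem_ker.2 (congrFun hx hv)⟩, rfl⟩

/-- The cokernel of a morphism of representations. -/
def cokerRep {X Y : LinRep k n} (f : X ⟶ Y) : LinRep k n :=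
  quotRep Y (fun l => LinearMap.range (vertexMap f l)) (trans_mem_range f)

/-- The projection to the cokernel of a morphism of representations. -/
def cokerRepπ {X Y : LinRep k n} (f : X ⟶ Y) : Y ⟶ cokerRep f :=
  quotRepπ Y _ (trans_mem_range f)

lemma barMap_cokerRepπ_surjective {X Y : LinRep k n} (f : X ⟶ Y) (v : ℕ) :
    Function.Surjective (barMap (cokerRepπ f) v) := fun y => by
  choose x hx using fun hv => Submodule.mkQ_surjective (LinearMap.range (vertexMap f _)) (y hv)
  exact ⟨x, funext hx⟩

lemma barMap_cokerRepπ_eq_zero_iff {X Y : LinRep k n} (f : X ⟶ Y) {v : ℕ} (y : Bar Y v) :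
    barMap (cokerRepπ f) v y = 0 ↔ ∃ x, barMap f v x = y := by
  constructor
  · intro h
    have h1 : ∀ hv, ∃ x, vertexMap f _ x = y hv := fun hv => by
      have : Submodule.mkQ (LinearMap.range (vertexMap f _)) (y hv) = 0 := congrFun h hv
      rwa [Submodule.mkQ_apply, Submodule.Quotient.mk_eq_zero] at this
    choose x hx using h1
    exact ⟨x, funext hx⟩
  · rintro ⟨x, rfl⟩
    funext hv
    exact (Submodule.Quotient.mk_eq_zero _).2 ⟨x hv, rfl⟩

/-- Together with `bijective_tr_cokerRep` this closes left perpendicular categories under kernels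
and cokernels, once perpendicularity is expressed by bijective structure maps. -/
lemma bijective_tr_kerRep {X Y : LinRep k n} (f : X ⟶ Y) {r s : ℕ} (h : r ≤ s)
    (hX : Function.Bijective (tr X h)) (hY : Function.Bijective (tr Y h)) :
    Function.Bijective (tr (kerRep f) h) := by
  constructor
  · intro x y hxy
    apply barMap_kerRepι_injective f
    apply hX.1
    rw [← barMap_tr, ← barMap_tr, hxy]
  · intro y
    obtain ⟨x, hx⟩ := hX.2 (barMap (kerRepι f) s y)
    have h0 : barMap f r x = 0 := by
      apply hY.1
      rw [← barMap_tr, hx, map_zero, ← barMap_comp, kerRepι_comp, barMap_zero]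
    obtain ⟨z, rfl⟩ := exists_barMap_kerRepι f h0
    refine ⟨z, barMap_kerRepι_injective f s ?_⟩
    rw [barMap_tr, hx]

lemma bijective_tr_cokerRep {X Y : LinRep k n} (f : X ⟶ Y) {r s : ℕ} (h : r ≤ s)
    (hX : Function.Bijective (tr X h)) (hY : Function.Bijective (tr Y h)) :
    Function.Bijective (tr (cokerRep f) h) := by
  constructor
  · rw [injective_iff_map_eq_zero]
    intro z hz
    obtain ⟨y, rfl⟩ := barMap_cokerRepπ_surjective f r z
    rw [← barMap_tr, barMap_cokerRepπ_eq_zero_iff] at hz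
    obtain ⟨x, hx⟩ := hz
    obtain ⟨x, rfl⟩ := hX.2 x
    rw [barMap_tr] at hx
    exact (barMap_cokerRepπ_eq_zero_iff f _).2 ⟨x, hY.1 hx⟩
  · intro z
    obtain ⟨y, rfl⟩ := barMap_cokerRepπ_surjective f s z
    obtain ⟨y, rfl⟩ := hY.2 y
    exact ⟨barMap (cokerRepπ f) r y, (barMap_tr _ _ _).symm⟩

lemma bijective_tr_of_retract {X Y : LinRep k n} (i : Y ⟶ X) (p : X ⟶ Y) (hip : i ≫ p = 𝟙 Y)
    {r s : ℕ} (h : r ≤ s) (hX : Function.Bijective (tr X h)) :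
    Function.Bijective (tr Y h) := by
  have hpi : ∀ v x, barMap p v (barMap i v x) = x := fun v x => by
    rw [← barMap_comp, hip, barMap_id]
  constructor
  · intro x y hxy
    rw [← hpi r x, ← hpi r y]
    congr 1
    apply hX.1
    rw [← barMap_tr, ← barMap_tr, hxy]
  · intro y
    obtain ⟨x, hx⟩ := hX.2 (barMap i s y)
    exact ⟨barMap p r x, by rw [← barMap_tr, hx, hpi]⟩

/-- A morphism of representations is injective at all vertices if the inclusion of its kernel
vanishes. -/
lemma barMap_injective_of_kerRepι_eq_zero {X Y : LinRep k n} (f : X ⟶ Y) (h : kerRepι f = 0)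
    (v : ℕ) : Function.Injective (barMap f v) := by
  rw [injective_iff_map_eq_zero]
  intro x hx
  obtain ⟨y, rfl⟩ := exists_barMap_kerRepι f hx
  rw [h, barMap_zero]

lemma barMap_injective_of_mono {X Y : LinRep k n} (f : X ⟶ Y) [Mono f] (v : ℕ) :
    Function.Injective (barMap f v) :=
  barMap_injective_of_kerRepι_eq_zero f
    (by rw [← cancel_mono f, kerRepι_comp, zero_comp]) v

/-- A linear form on a subspace, given by an injective map, extends if it is compatible with a
further map; here it extends by zero along `t`. -/
lemma exists_form_extension {V V' U : Type*} [AddCommGroup V] [Module k V] [AddCommGroup V']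
    [Module k V'] [AddCommGroup U] [Module k U] (f : V →ₗ[k] V') (t : U →ₗ[k] V')
    (φ : V →ₗ[k] k) (h : ∀ x y, f x = t y → φ x = 0) :
    ∃ ψ : V' →ₗ[k] k, ψ.comp f = φ ∧ ψ.comp t = 0 := by
  let P := LinearMap.range t
  let F : V →ₗ[k] V' ⧸ P := P.mkQ.comp f
  have hker : LinearMap.ker F ≤ LinearMap.ker φ := by
    intro x hx
    have : f x ∈ P := by
      rw [← Submodule.Quotient.mk_eq_zero]
      exact hx
    obtain ⟨y, hy⟩ := this
    exact h x y hy.symm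
  -- `φ` descends to the quotient by `ker F`, which embeds in `V' ⧸ P`; a linear left inverse of
  -- this embedding extends it.
  obtain ⟨ψ, hψ⟩ : ∃ ψ : (V' ⧸ P) →ₗ[k] k, ψ.comp F = φ := by
    obtain ⟨g, hg⟩ := (LinearMap.ker F).liftQ F le_rfl |>.exists_leftInverse_of_injective
      (Submodule.ker_liftQ_eq_bot _ _ _ le_rfl)
    refine ⟨((LinearMap.ker F).liftQ φ hker).comp g, LinearMap.ext fun x => ?_⟩
    have := LinearMap.congr_fun hg ((LinearMap.ker F).mkQ x)
    simp only [LinearMap.comp_apply, Submodule.mkQ_apply, Submodule.liftQ_apply,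
      LinearMap.id_apply] at this ⊢
    rw [this, Submodule.liftQ_apply]
  refine ⟨ψ.comp P.mkQ, hψ, LinearMap.ext fun y => ?_⟩
  have : P.mkQ (t y) = 0 := (Submodule.Quotient.mk_eq_zero _).2 ⟨y, rfl⟩
  simp only [LinearMap.comp_apply, this, map_zero, LinearMap.zero_apply]

/-- A morphism to `M_{r,s}` extends along `f` if the linear form vanishes on the elements that
become images of the vector space at `r`. -/
lemma exists_hom_M_extension {X Y : LinRep k n} (f : X ⟶ Y) {r s : Fin (n + 1)} (h : r < s)
    (g : X ⟶ M k r s)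
    (hg : ∀ x y, barMap f s x = tr Y (show r.val ≤ s.val from h.le) y → formOf h g x = 0) :
    ∃ g' : Y ⟶ M k r s, f ≫ g' = g := by
  obtain ⟨ψ, h1, h2⟩ := exists_form_extension (barMap f s)
    (tr Y (show r.val ≤ s.val from h.le)) (formOf h g) hg
  refine ⟨toM Y h.le ψ fun x => LinearMap.congr_fun h2 x, hom_M_ext h ?_⟩
  rw [formOf_comp, formOf_toM, h1]

/-- The extension condition is only about the image of the vertex `0`, where every representation is
zero. -/
lemma injective_M_zero {s : Fin (n + 1)} (hs : 0 < s) : Injective (M k 0 s) where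
  factors {X Y} g f hf := by
    refine exists_hom_M_extension f hs g fun x y hxy => ?_
    rw [bar_eq_zero Y (by simp) y, map_zero] at hxy
    rw [barMap_injective_of_mono f s.val (hxy.trans (map_zero _).symm), map_zero]

/-! ### The canonical injective resolution of an interval representation -/

section Resolution

variable (k) (r s : Fin (n + 1)) (h : r < s)

/-- The inclusion `M_{r,s} → M_{0,s}`. -/
def resι : M k r s ⟶ M k 0 s :=
  toM _ (Fin.zero_le s) (formOf h (𝟙 (M k r s)))
    (fun x => by rw [bar_eq_zero (M k r s) (by simp) x, map_zero, map_zero])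

/-- The projection `M_{0,s} → M_{0,r}`; it is given on linear forms by the structure map from `r`
to `s`. -/
def resπ : M k 0 s ⟶ M k 0 r :=
  toM _ (Fin.zero_le r) ((formOf ((Fin.zero_le r).trans_lt h) (𝟙 (M k 0 s))).comp
      (tr (M k 0 s) (show r.val ≤ s.val from h.le)))
    (fun x => by rw [bar_eq_zero (M k 0 s) (by simp) x, map_zero, map_zero])

variable {k r s}

/-- In terms of linear forms, `resι` forgets that a form at `s` vanishes on the image from `r`, and
`resπ` restricts a form along the structure map from `r` to `s`. This makes exactness visible. -/
lemma formOf_resι {X : LinRep k n} (f : X ⟶ M k r s) :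
    formOf ((Fin.zero_le r).trans_lt h) (f ≫ resι k r s h) = formOf h f := by
  rw [formOf_comp, resι, formOf_toM]
  rfl

lemma formOf_resπ (hr : 0 < r) {X : LinRep k n} (f : X ⟶ M k 0 s) :
    formOf hr (f ≫ resπ k r s h) = (formOf ((Fin.zero_le r).trans_lt h) f).comp
      (tr X (show r.val ≤ s.val from h.le)) := by
  rw [formOf_comp, resπ, formOf_toM]
  refine LinearMap.ext fun x => ?_
  rw [LinearMap.comp_apply, LinearMap.comp_apply, ← barMap_tr]
  rfl

lemma resι_resπ : resι k r s h ≫ resπ k r s h = 0 := by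
  by_cases hr : 0 < r
  · refine hom_M_ext hr (LinearMap.ext fun x => ?_)
    rw [formOf_resπ, formOf_zero, ← Category.id_comp (resι k r s h), formOf_resι,
      LinearMap.comp_apply, formOf_tr, LinearMap.zero_apply]
  · exact hom_M_eq_zero hr _

lemma coord_resπ {v : ℕ} (hv : (0 : Fin (n + 1)).val < v ∧ v ≤ r.val) (x : Bar (M k 0 s) v) :
    coord 0 r hv (barMap (resπ k r s h) v x) = coord 0 s ⟨hv.1, hv.2.trans h.le⟩ x := by
  rw [resπ, coord_toM, LinearMap.comp_apply, tr_tr, formOf_apply, barMap_id, coord_tr]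

instance mono_resι : Mono (resι k r s h) where
  right_cancellation f g hfg := hom_M_ext h (by
    rw [← formOf_resι h f, hfg, formOf_resι])

instance epi_resπ : Epi (resπ k r s h) where
  left_cancellation f g hfg := by
    refine rep_hom_ext_bar fun v x => ?_
    obtain ⟨y, rfl⟩ : ∃ y, barMap (resπ k r s h) v y = x := by
      by_cases hv : (0 : Fin (n + 1)).val < v ∧ v ≤ r.val
      · exact ⟨constBar 0 s v (coord 0 r hv x), barM_ext fun _ => by
          rw [coord_resπ, coord_constBar]⟩
      · exact ⟨0, (barM_eq_zero hv _).trans (barM_eq_zero hv x).symm⟩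
    rw [← barMap_comp, hfg, barMap_comp]

/-- The sequence `0 → M_{r,s} → M_{0,s} → M_{0,r} → 0`. -/
abbrev resSeq : ShortComplex (LinRep k n) :=
  ShortComplex.mk (resι k r s h) (resπ k r s h) (resι_resπ h)

/-- A form at `s` is killed by `resπ` exactly when it vanishes on the image from `r`, which is the
condition for a morphism to `M_{r,s}`. -/
lemma shortExact_resSeq : (resSeq (k := k) h).ShortExact where
  exact := by
    apply ShortComplex.exact_of_f_is_kernel
    refine KernelFork.IsLimit.ofι' _ _ fun {A} g hg => ⟨toM A h.le
      (formOf ((Fin.zero_le r).trans_lt h) g) ?_, ?_⟩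
    · intro x
      by_cases hr : 0 < r
      · have := formOf_resπ h hr g
        rw [show g ≫ resπ k r s h = 0 from hg, formOf_zero] at this
        exact (LinearMap.congr_fun this x).symm
      · have hr' : r = 0 := not_not.1 fun h0 => hr (Fin.pos_of_ne_zero h0)
        rw [bar_eq_zero A (by simp [hr']) x, map_zero, map_zero]
    · refine hom_M_ext ((Fin.zero_le r).trans_lt h) ?_
      rw [formOf_resι, formOf_toM]
  mono_f := mono_resι h
  epi_g := epi_resπ h

end Resolution

/-! ### Orthogonality to interval representations and extraction of interval summands -/

/-- For a short exact sequence `S` whose middle term is injective, `Ext^1(X, S.X₁) = 0` if and only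
if all morphisms from `X` to `S.X₃` lift to `S.X₂`. -/
lemma subsingleton_ext_iff_forall_lift {S : ShortComplex (LinRep k n)} (hS : S.ShortExact)
    [Injective S.X₂] (X : LinRep k n) :
    Subsingleton (Abelian.Ext X S.X₁ 1) ↔ ∀ g : X ⟶ S.X₃, ∃ f : X ⟶ S.X₂, f ≫ S.g = g := by
  constructor
  · intro hsub g
    obtain ⟨x, hx⟩ := Abelian.Ext.covariant_sequence_exact₃ X hS (Abelian.Ext.mk₀ g)
      (zero_add 1) (Subsingleton.elim _ _)
    obtain ⟨f, rfl⟩ := (Abelian.Ext.mk₀_bijective X S.X₂).2 x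
    rw [Abelian.Ext.mk₀_comp_mk₀] at hx
    exact ⟨f, (Abelian.Ext.mk₀_bijective _ _).1 hx⟩
  · intro hf
    refine subsingleton_of_forall_eq 0 fun x => ?_
    obtain ⟨y, rfl⟩ := Abelian.Ext.covariant_sequence_exact₁ X hS x
      (Abelian.Ext.eq_zero_of_injective _) (zero_add 1)
    obtain ⟨g, rfl⟩ := (Abelian.Ext.mk₀_bijective X S.X₃).2 y
    obtain ⟨f, rfl⟩ := hf g
    rw [← Abelian.Ext.mk₀_comp_mk₀, Abelian.Ext.comp_assoc_of_second_deg_zero, hS.comp_extClass,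
      Abelian.Ext.comp_zero]

/-- `Ext^1(X, M_{r,s}) = 0` if and only if the structure map of `X` from `r` to `s` is
injective. -/
lemma subsingleton_ext_M_iff (X : LinRep k n) {r s : Fin (n + 1)} (h : r < s) :
    Subsingleton (Abelian.Ext X (M k r s) 1) ↔
      Function.Injective (tr X (show r.val ≤ s.val from h.le)) := by
  have h0 := (Fin.zero_le r).trans_lt h
  have hlift : (∀ g : X ⟶ M k 0 r, ∃ f : X ⟶ M k 0 s, f ≫ resπ k r s h = g) ↔
      Function.Injective (tr X (show r.val ≤ s.val from h.le)) := by
    by_cases hr : 0 < r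
    · constructor
      · intro hf
        rw [injective_iff_map_eq_zero]
        intro x hx
        by_contra hne
        -- Every form at `r` is a morphism to `M_{0,r}`; a lift makes it factor through the
        -- structure map, so it kills `x`.
        refine hne ((Module.forall_dual_apply_eq_zero_iff k x).1 fun φ => ?_)
        have hφ : ∀ y, φ (tr X (Fin.zero_le r) y) = 0 := fun y => by
          rw [bar_eq_zero X (by simp) y, map_zero, map_zero]
        obtain ⟨f, hf⟩ := hf (toM X (Fin.zero_le r) φ hφ)
        rw [← formOf_toM X hr φ hφ, ← hf, formOf_resπ, LinearMap.comp_apply, hx, map_zero]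
      · intro hinj g
        obtain ⟨ψ, hψ⟩ := LinearMap.exists_leftInverse_of_injective _
          (LinearMap.ker_eq_bot.2 hinj)
        refine ⟨toM X (Fin.zero_le s) ((formOf hr g).comp ψ) fun x => ?_, hom_M_ext hr ?_⟩
        · rw [bar_eq_zero X (by simp) x, map_zero, map_zero]
        · rw [formOf_resπ, formOf_toM, LinearMap.comp_assoc, hψ, LinearMap.comp_id]
    · have hr' : r = 0 := not_not.1 fun h0 => hr (Fin.pos_of_ne_zero h0)
      refine iff_of_true (fun g => ⟨0, ?_⟩) fun x y _ => ?_
      · rw [hom_M_eq_zero hr g, zero_comp]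
      · rw [bar_eq_zero X (by simp [hr']) x, bar_eq_zero X (by simp [hr']) y]
  rw [← hlift]
  have : Injective (resSeq (k := k) h).X₂ := injective_M_zero h0
  exact subsingleton_ext_iff_forall_lift (shortExact_resSeq h) X

/-- `M_{r,s}` is right orthogonal to `X` if and only if the structure map of `X` from `r` to `s`
is bijective. -/
lemma orth_M_iff (X : LinRep k n) {r s : Fin (n + 1)} (h : r < s) :
    Orth X (M k r s) ↔ Function.Bijective (tr X (show r.val ≤ s.val from h.le)) := by
  rw [Orth, subsingleton_hom_M_iff X h, subsingleton_ext_M_iff X h, Function.Bijective, and_comm]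

lemma Orth.of_retract {X V W : LinRep k n} (hV : Orth X V) (i : W ⟶ V) (p : V ⟶ W)
    (hip : i ≫ p = 𝟙 W) : Orth X W := by
  have := hV.1
  have := hV.2
  constructor
  · refine ⟨fun f g => ?_⟩
    rw [← Category.comp_id f, ← Category.comp_id g, ← hip, ← Category.assoc, ← Category.assoc,
      Subsingleton.elim (f ≫ i) (g ≫ i)]
  · refine subsingleton_of_forall_eq 0 fun x => ?_
    rw [← Abelian.Ext.comp_mk₀_id x, ← hip, ← Abelian.Ext.mk₀_comp_mk₀,
      ← Abelian.Ext.comp_assoc_of_second_deg_zero,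
      Subsingleton.elim (x.comp (Abelian.Ext.mk₀ i) (add_zero 1)) 0]
    simp

lemma orth_biproduct_iff {J : Type} [Fintype J] (X : LinRep k n) (V : J → LinRep k n) :
    Orth X (⨁ V) ↔ ∀ j, Orth X (V j) := by
  classical
  constructor
  · intro h j
    exact h.of_retract (biproduct.ι V j) (biproduct.π V j) (biproduct.ι_π_self V j)
  · intro h
    have h1 := fun j => (h j).1
    have h2 := fun j => (h j).2
    exact ⟨⟨fun f g => biproduct.hom_ext _ _ fun j => Subsingleton.elim _ _⟩,
      (Abelian.Ext.addEquivBiproduct X (biproduct.isBilimit V) 1).toEquiv.subsingleton⟩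

/-- If the structure map of `X` from `i` to `j` is not injective, then `X` has a direct summand
`M_{p,q}` with the same property. -/
lemma exists_retract_of_not_injective (X : LinRep k n) {i j : ℕ} (hij : i ≤ j)
    (hX : ¬ Function.Injective (tr X hij)) :
    ∃ p q : Fin (n + 1), p.val < i ∧ i ≤ q.val ∧ q.val < j ∧
      ∃ (f : M k p q ⟶ X) (r : X ⟶ M k p q), f ≫ r = 𝟙 (M k p q) := by
  classical
  have hlt : i < j := by
    rcases hij.lt_or_eq with h | rfl
    · exact h
    · exact absurd (fun x y h => by rwa [tr_refl, tr_refl] at h) hX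
  -- The right end `q` is the earliest possible death: some nonzero vector at `i` dies at `q + 1`,
  -- while the map from `i` to `q` is still injective.
  have hex : ∃ q : ℕ, ∃ h : i ≤ q + 1, ∃ x : Bar X i, x ≠ 0 ∧ tr X h x = 0 := by
    rw [injective_iff_map_eq_zero] at hX
    push Not at hX
    obtain ⟨x, hx, hx0⟩ := hX
    obtain ⟨j, rfl⟩ : ∃ j', j = j' + 1 := ⟨j - 1, by omega⟩
    exact ⟨j, hij, x, hx0, hx⟩
  have hqj : Nat.find hex < j := by
    rw [injective_iff_map_eq_zero] at hX
    push Not at hX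
    obtain ⟨x, hx, hx0⟩ := hX
    obtain ⟨j, rfl⟩ : ∃ j', j = j' + 1 := ⟨j - 1, by omega⟩
    exact Nat.lt_succ_of_le (Nat.find_min' hex ⟨hij, x, hx0, hx⟩)
  obtain ⟨hq, x, hx0, hx⟩ := Nat.find_spec hex
  have hmin := fun q hq => Nat.find_min hex (m := q) hq
  generalize Nat.find hex = q at hqj hq hx hmin
  have hin : 1 ≤ i ∧ i ≤ n := by
    by_contra h
    exact hx0 (bar_eq_zero X h x)
  have hiq : i ≤ q := by
    by_contra h
    obtain rfl : i = q + 1 := by omega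
    rw [tr_refl] at hx
    exact hx0 hx
  have hinjq : ∀ y : Bar X i, tr X hiq y = 0 → y = 0 := by
    intro y hy
    by_contra hy0
    rcases hiq.lt_or_eq with h | rfl
    · obtain ⟨q, rfl⟩ : ∃ q', q = q' + 1 := ⟨q - 1, by omega⟩
      exact hmin q (by omega) ⟨by omega, y, hy0, hy⟩
    · rw [tr_refl] at hy
      exact hy0 hy
  have hqn : q ≤ n := by
    by_contra h
    exact hx0 (hinjq x (bar_eq_zero X (by omega) _))
  -- The left end is the earliest possible birth of a vector that survives to `i` and dies at `q +
  -- 1`; a preimage at `p` would be born earlier.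
  have hexp : ∃ p : ℕ, ∃ h : p + 1 ≤ i, ∃ y : Bar X (p + 1), tr X h y ≠ 0 ∧
      tr X (h.trans hq) y = 0 := by
    obtain ⟨i, rfl⟩ : ∃ i', i = i' + 1 := ⟨i - 1, by omega⟩
    exact ⟨i, le_rfl, x, by rwa [tr_refl], hx⟩
  obtain ⟨hp, y, hy0, hy⟩ := Nat.find_spec hexp
  have hminp := fun p hp => Nat.find_min hexp (m := p) hp
  generalize Nat.find hexp = p at hp y hy0 hy hminp
  refine ⟨⟨p, by omega⟩, ⟨q, by omega⟩, hp, hiq, hqj, ?_⟩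
  refine exists_retract X (p := ⟨p, by omega⟩) (q := ⟨q, by omega⟩)
    (Fin.mk_lt_mk.2 (by omega)) y hy fun z hz => ?_
  have hpi : p ≤ i := by omega
  have h1 : tr X hpi z = tr X hp y := by
    rw [← sub_eq_zero]
    apply hinjq
    rw [map_sub, tr_tr, tr_tr, sub_eq_zero]
    exact hz
  have hp0 : p ≠ 0 := by
    rintro rfl
    rw [bar_eq_zero X (by simp) z, map_zero] at h1
    exact hy0 h1.symm
  obtain ⟨p, rfl⟩ : ∃ p', p = p' + 1 := ⟨p - 1, by omega⟩
  refine hminp p (by omega) ⟨hpi, z, by rwa [h1], ?_⟩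
  rw [← tr_tr X hpi hq, h1, tr_tr, hy]

/-! ### Injective objects of a left perpendicular category -/

section RelInjective

variable {V : LinRep k n} {J : Type*} {a b : J → Fin (n + 1)} (hab : ∀ m, a m < b m)
  (hV : ∀ W, leftPerp V W ↔
    ∀ m, Function.Bijective (tr W (show (a m).val ≤ (b m).val from (hab m).le)))

include hab hV

/-- A monomorphism of the subcategory can be cancelled only against its own objects, but the kernel
is one of them. -/
lemma barMap_injective_of_mono_leftPerp {X Y : (leftPerp V).FullSubcategory} (f : X ⟶ Y) [Mono f]
    (v : ℕ) : Function.Injective (barMap f.hom v) := by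
  refine barMap_injective_of_kerRepι_eq_zero f.hom ?_ v
  have hK : leftPerp V (kerRep f.hom) := (hV _).2 fun m =>
    bijective_tr_kerRep f.hom _ ((hV _).1 X.property m) ((hV _).1 Y.property m)
  let g : (⟨kerRep f.hom, hK⟩ : (leftPerp V).FullSubcategory) ⟶ X :=
    ObjectProperty.homMk (kerRepι f.hom)
  have hg : g = ObjectProperty.homMk 0 := by
    rw [← cancel_mono f]
    apply ObjectProperty.hom_ext
    exact (kerRepι_comp f.hom).trans zero_comp.symm
  exact congrArg (fun g => g.hom) hg

/-- `M_{i,j}` is relatively injective if the structure maps from `i` to `j` of all objects of the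
left perpendicular category are injective. -/
lemma isRelInjectiveWrt_of_forall_injective {X : LinRep k n} (hX : leftPerp V X)
    {i j : Fin (n + 1)} (hij : i < j) (e : X ≅ M k i j)
    (hinj : ∀ Z, leftPerp V Z →
      Function.Injective (tr Z (show i.val ≤ j.val from hij.le))) :
    IsRelInjectiveWrt V X := by
  refine ⟨hX, ⟨fun {W W'} g f _ => ?_⟩⟩
  have hf := barMap_injective_of_mono_leftPerp hab hV f
  have hZ : leftPerp V (cokerRep f.hom) := (hV _).2 fun m =>
    bijective_tr_cokerRep f.hom _ ((hV _).1 W.property m) ((hV _).1 W'.property m)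
  obtain ⟨g', hg'⟩ := exists_hom_M_extension f.hom hij (g.hom ≫ e.hom) fun x y hxy => by
    -- The class of `y` dies in the cokernel at `j`, hence is zero at `i` by `hinj`. So `y` comes
    -- from some `z` in `W`, and `x` is the image of `z`, where the form vanishes.
    have h0 : tr (cokerRep f.hom) (show i.val ≤ j.val from hij.le)
        (barMap (cokerRepπ f.hom) _ y) = 0 := by
      rw [← barMap_tr, ← hxy, barMap_cokerRepπ_eq_zero_iff]
      exact ⟨x, rfl⟩
    have h1 := hinj _ hZ (h0.trans (map_zero _).symm)
    rw [barMap_cokerRepπ_eq_zero_iff] at h1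
    obtain ⟨z, rfl⟩ := h1
    rw [← barMap_tr] at hxy
    rw [hf _ hxy, formOf_tr]
  refine ⟨ObjectProperty.homMk (g' ≫ e.inv), ?_⟩
  apply ObjectProperty.hom_ext
  change f.hom ≫ g' ≫ e.inv = g.hom
  rw [← Category.assoc, hg', Category.assoc, e.hom_inv_id, Category.comp_id]

omit hab hV in
/-- `M_{i,j}` is not relatively injective if the left perpendicular category contains some
`M_{p,j}` with `p < i`. -/
lemma not_isRelInjectiveWrt_of_lt {X : LinRep k n} {p i j : Fin (n + 1)} (hpi : p < i)
    (hij : i < j) (e : X ≅ M k i j) (hp : leftPerp V (M k p j)) : ¬ IsRelInjectiveWrt V X := by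
  rintro ⟨hX, hinj⟩
  have hpj := hpi.trans hij
  let f : M k i j ⟶ M k p j := toM _ hpj.le (formOf hij (𝟙 _)) fun x => by
    rw [barM_eq_zero (by have : p.val < i.val := hpi; omega) x, map_zero, map_zero]
  have hf : Mono f := ⟨fun g g' hg => hom_M_ext hij (by
    have h1 : ∀ {Y} (g : Y ⟶ M k i j), formOf hij g = formOf hpj (g ≫ f) := fun g => by
      rw [formOf_comp, formOf_toM]
      rfl
    rw [h1, h1, hg])⟩
  let F : (⟨X, hX⟩ : (leftPerp V).FullSubcategory) ⟶ ⟨M k p j, hp⟩ :=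
    ObjectProperty.homMk (e.hom ≫ f)
  have hF : Mono F := ⟨fun g g' hg => by
    apply ObjectProperty.hom_ext
    rw [← cancel_mono (e.hom ≫ f)]
    exact congrArg (fun g => g.hom) hg⟩
  obtain ⟨G, hG⟩ := hinj.factors (𝟙 _) F
  have h1 : (e.hom ≫ f) ≫ G.hom = 𝟙 X := congrArg (fun g => g.hom) hG
  have h2 : f ≫ (G.hom ≫ e.hom) = 𝟙 (M k i j) := by
    rw [← cancel_epi e.hom, ← Category.assoc, ← Category.assoc, h1, Category.id_comp,
      Category.comp_id]
  -- A form that belongs to a morphism to `M_{i,j}` vanishes on the image from `i`, which is all of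
  -- `M_{p,j}` at `j`.
  have h3 : G.hom ≫ e.hom = 0 := by
    refine hom_M_ext hij (LinearMap.ext fun x => ?_)
    have hb : Function.Bijective (tr (M k p j) (show i.val ≤ j.val from hij.le)) := by
      rw [bijective_tr_M_iff]
      have : p.val < i.val := hpi
      have : i.val < j.val := hij
      omega
    obtain ⟨y, rfl⟩ := hb.2 x
    rw [formOf_tr, formOf_zero, LinearMap.zero_apply]
  rw [h3, comp_zero] at h2
  have h4 := congrArg (fun g => formOf hij g (constBar _ _ _ 1)) h2
  simp only [formOf_zero, formOf_apply, barMap_id, coord_constBar, LinearMap.zero_apply] at h4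
  exact zero_ne_one h4

end RelInjective

end Rep

/-! ### Linear algebra of dimension vectors -/

section DimVec

variable {n : ℕ}

/-- The dimension vector of `M_{p,q}`. -/
def dimVec (p q : Fin (n + 1)) : Fin n → ℚ := fun v => if InSupp p q v then 1 else 0

/-- The linear form on dimension vectors that takes the difference of the dimensions at the
vertices `s` and `r`, where the vertex `0` has dimension zero. -/
def diffForm (r s : Fin (n + 1)) : (Fin n → ℚ) →ₗ[ℚ] ℚ where
  toFun x := (Fin.cons 0 x : Fin (n + 1) → ℚ) s - (Fin.cons 0 x : Fin (n + 1) → ℚ) r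
  map_add' x y := by
    cases r using Fin.cases <;> cases s using Fin.cases <;> simp <;> ring
  map_smul' c x := by
    cases r using Fin.cases <;> cases s using Fin.cases <;> simp [mul_sub]

lemma cons_dimVec (p q v : Fin (n + 1)) :
    (Fin.cons 0 (dimVec p q) : Fin (n + 1) → ℚ) v = if p < v ∧ v ≤ q then 1 else 0 := by
  cases v using Fin.cases with
  | zero => simp
  | succ v =>
    rw [Fin.cons_succ, dimVec]
    rfl

lemma diffForm_dimVec (r s p q : Fin (n + 1)) :
    diffForm r s (dimVec p q) =
      (if p < s ∧ s ≤ q then 1 else 0) - (if p < r ∧ r ≤ q then 1 else 0) := by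
  rw [← cons_dimVec, ← cons_dimVec]
  rfl

/-- The linear form on dimension vectors that takes `dimVec p q` to `g q - g p`. -/
def potForm (g : Fin (n + 1) → ℚ) : (Fin n → ℚ) →ₗ[ℚ] ℚ where
  toFun x := ∑ v, x v * (g v.succ - g v.castSucc)
  map_add' x y := by simp [add_mul, Finset.sum_add_distrib]
  map_smul' c x := by simp [Finset.mul_sum, mul_assoc]

lemma potForm_apply (g : Fin (n + 1) → ℚ) (x : Fin n → ℚ) :
    potForm g x = ∑ v, x v * (g v.succ - g v.castSucc) := rfl

lemma dimVec_self (p : Fin (n + 1)) : dimVec p p = 0 := by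
  funext v
  exact if_neg fun h => by simp only [InSupp] at h; omega

lemma dimVec_succ (p : Fin (n + 1)) (v : Fin n) (h : p ≤ v.castSucc) :
    dimVec p v.succ = dimVec p v.castSucc + Pi.single v 1 := by
  funext w
  have hp : p.val ≤ v.val := h
  by_cases hw : w = v
  · subst hw
    have h1 : InSupp p w.succ w := ⟨Nat.lt_succ_of_le hp, by simp⟩
    have h2 : ¬ InSupp p w.castSucc w := fun h => by
      simp only [InSupp, Fin.val_castSucc] at h; omega
    simp [dimVec, h1, h2]
  · have hwv : w.val ≠ v.val := fun h => hw (Fin.ext h)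
    have h1 : InSupp p v.succ w ↔ InSupp p v.castSucc w := by
      simp only [InSupp, Fin.val_succ, Fin.val_castSucc]; omega
    simp [dimVec, h1, hw]

lemma potForm_dimVec (g : Fin (n + 1) → ℚ) {p q : Fin (n + 1)} (h : p ≤ q) :
    potForm g (dimVec p q) = g q - g p := by
  induction q using Fin.induction with
  | zero =>
    obtain rfl : p = 0 := Fin.le_zero_iff.1 h
    rw [dimVec_self, map_zero, sub_self]
  | succ v ih =>
    rcases h.lt_or_eq with hlt | rfl
    · have hle : p ≤ v.castSucc := Fin.le_castSucc_iff.2 hlt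
      rw [dimVec_succ p v hle, map_add, ih hle, potForm_apply, Finset.sum_eq_single v]
      · simp
      · intro w _ hw
        simp [hw]
      · simp
    · rw [dimVec_self, map_zero, sub_self]

/-! ### Exceptional sequences of intervals and their triangular linear forms -/

/-- The intervals `(a l, b l]` are those of an exceptional sequence. -/
structure IsExcPairs (a b : Fin n → Fin (n + 1)) : Prop where
  lt : ∀ l, a l < b l
  orth : ∀ {m l}, m < l → ((a l < a m ∧ a m ≤ b l) ↔ (a l < b m ∧ b m ≤ b l))

variable {a b : Fin n → Fin (n + 1)}

lemma IsExcPairs.diffForm_self (h : IsExcPairs a b) (l : Fin n) :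
    diffForm (a l) (b l) (dimVec (a l) (b l)) = 1 := by
  rw [diffForm_dimVec, if_pos ⟨h.lt l, le_rfl⟩, if_neg fun h' => lt_irrefl _ h'.1, sub_zero]

lemma IsExcPairs.diffForm_of_lt (h : IsExcPairs a b) {m l : Fin n} (hml : m < l) :
    diffForm (a m) (b m) (dimVec (a l) (b l)) = 0 := by
  rw [diffForm_dimVec]
  simp only [h.orth hml, sub_self]

/-- The coefficients of a linear combination are determined one after the other by the linear
forms of the sequence. -/
lemma IsExcPairs.coeff_eq (h : IsExcPairs a b) (c : Fin n → ℚ) (l : Fin n)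
    (h0 : ∀ t < l, diffForm (a t) (b t) (∑ m, c m • dimVec (a m) (b m)) = 0) :
    c l = diffForm (a l) (b l) (∑ m, c m • dimVec (a m) (b m)) := by
  induction l using WellFoundedLT.induction with
  | ind l ih =>
    have hz : ∀ t < l, c t = 0 := fun t ht => by
      rw [ih t ht fun t' ht' => h0 t' (ht'.trans ht), h0 t ht]
    rw [map_sum, Finset.sum_eq_single l]
    · rw [map_smul, h.diffForm_self, smul_eq_mul, mul_one]
    · intro m _ hm
      rcases lt_or_gt_of_ne hm with hlt | hgt
      · rw [hz m hlt, zero_smul, map_zero]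
      · rw [map_smul, h.diffForm_of_lt hgt, smul_zero]
    · simp

lemma IsExcPairs.linearIndependent (h : IsExcPairs a b) :
    LinearIndependent ℚ fun m => dimVec (a m) (b m) := by
  rw [Fintype.linearIndependent_iff]
  intro c hc l
  rw [h.coeff_eq c l fun t _ => by rw [hc, map_zero], hc, map_zero]

lemma IsExcPairs.exists_coeff (h : IsExcPairs a b) (x : Fin n → ℚ) :
    ∃ c : Fin n → ℚ, ∑ m, c m • dimVec (a m) (b m) = x := by
  have := h.linearIndependent.span_eq_top_of_card_eq_finrank' (by simp)
  exact (Submodule.mem_span_range_iff_exists_fun ℚ).1 (this ▸ Submodule.mem_top)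

/-- A function on the vertices with equal values at the endpoints of all strands is constant. -/
lemma IsExcPairs.eq_of_forall_eq (h : IsExcPairs a b) (g : Fin (n + 1) → ℚ)
    (hg : ∀ l, g (a l) = g (b l)) (x : Fin (n + 1)) : g x = g 0 := by
  -- `potForm g` kills every basis vector, hence also `dimVec 0 x`, on which it takes the value `g x
  -- - g 0`.
  obtain ⟨c, hc⟩ := h.exists_coeff (dimVec 0 x)
  have h1 := potForm_dimVec g (Fin.zero_le x)
  rw [← hc, map_sum, Finset.sum_eq_zero] at h1
  · linarith
  · intro m _
    rw [map_smul, potForm_dimVec g (h.lt m).le, hg, sub_self, smul_zero]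

/-- If `(p, q]` is orthogonal to the members before `l`, then the change from `p` to `q` of a
function that only changes along the strand `l` is given by the linear form of `l`. -/
lemma IsExcPairs.sub_eq_diffForm (h : IsExcPairs a b) (g : Fin (n + 1) → ℚ) (l : Fin n)
    (hg : ∀ m, m ≠ l → g (a m) = g (b m)) (hl : g (b l) - g (a l) = 1) {p q : Fin (n + 1)}
    (hpq : p ≤ q) (h0 : ∀ t < l, diffForm (a t) (b t) (dimVec p q) = 0) :
    g q - g p = diffForm (a l) (b l) (dimVec p q) := by
  obtain ⟨c, hc⟩ := h.exists_coeff (dimVec p q)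
  rw [← hc] at h0
  rw [← potForm_dimVec g hpq, ← hc, ← h.coeff_eq c l h0, map_sum, Finset.sum_eq_single l]
  · rw [map_smul, potForm_dimVec g (h.lt l).le, hl, smul_eq_mul, mul_one]
  · intro m _ hm
    rw [map_smul, potForm_dimVec g (h.lt m).le, hg m hm, sub_self, smul_zero]
  · simp

/-! ### The strand diagram is a noncrossing tree -/

/-- The graph `T` has the strands `c(a l, b l)` as its edges. -/
def HasStrands (T : SimpleGraph (Fin (n + 1))) (a b : Fin n → Fin (n + 1)) : Prop :=
  ∀ x y, T.Adj x y ↔ ∃ l, (a l = x ∧ b l = y) ∨ (a l = y ∧ b l = x)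

variable {T : SimpleGraph (Fin (n + 1))}

lemma HasStrands.adj (hT : HasStrands T a b) (l : Fin n) : T.Adj (a l) (b l) :=
  (hT _ _).2 ⟨l, Or.inl ⟨rfl, rfl⟩⟩

lemma HasStrands.exists_of_lt (hT : HasStrands T a b) (h : IsExcPairs a b) {x y : Fin (n + 1)}
    (hxy : x < y) (hadj : T.Adj x y) : ∃ l, a l = x ∧ b l = y := by
  obtain ⟨l, hl | ⟨rfl, rfl⟩⟩ := (hT _ _).1 hadj
  · exact ⟨l, hl⟩
  · exact absurd (h.lt l) hxy.asymm

/-- An interval is not orthogonal to itself: it contains its right end and not its left end. -/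
lemma IsExcPairs.eq_of_eq (h : IsExcPairs a b) {l m : Fin n} (ha : a l = a m) (hb : b l = b m) :
    l = m := by
  by_contra hne
  rcases lt_or_gt_of_ne hne with hlt | hgt
  · have h1 := h.orth hlt
    have h2 := h.lt m
    rw [ha, hb] at h1
    exact lt_irrefl _ (h1.2 ⟨h2, le_rfl⟩).1
  · have h1 := h.orth hgt
    have h2 := h.lt l
    rw [← ha, ← hb] at h1
    exact lt_irrefl _ (h1.2 ⟨h2, le_rfl⟩).1

/-- The indicator function of the component of `0` agrees at the ends of every strand, so it is
constant. -/
lemma HasStrands.connected (hT : HasStrands T a b) (h : IsExcPairs a b) : T.Connected := by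
  classical
  refine SimpleGraph.connected_iff_exists_forall_reachable _ |>.2 ⟨0, fun x => ?_⟩
  have hg := h.eq_of_forall_eq (fun v => if T.Reachable 0 v then 1 else 0) (fun l => by
    have : T.Reachable 0 (a l) ↔ T.Reachable 0 (b l) :=
      ⟨fun h => h.trans (hT.adj l).reachable, fun h => h.trans (hT.adj l).reachable.symm⟩
    simp only [this]) x
  by_contra hx
  simp [hx] at hg

lemma HasStrands.isTree (hT : HasStrands T a b) (h : IsExcPairs a b) : T.IsTree := by
  rw [SimpleGraph.isTree_iff_connected_and_card]
  refine ⟨hT.connected h, ?_⟩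
  have hcard : Nat.card T.edgeSet = Nat.card (Fin n) := by
    symm
    refine Nat.card_congr (Equiv.ofBijective
      (fun l => (⟨s(a l, b l), hT.adj l⟩ : T.edgeSet)) ⟨fun l m hlm => ?_, ?_⟩)
    · have := congrArg Subtype.val hlm
      simp only [Sym2.eq_iff] at this
      rcases this with ⟨h1, h2⟩ | ⟨h1, h2⟩
      · exact h.eq_of_eq h1 h2
      · have h3 := h.lt l
        rw [h1, h2] at h3
        exact absurd (h.lt m) h3.asymm
    · rintro ⟨e, he⟩
      induction e using Sym2.ind with
      | _ x y =>
        obtain ⟨l, ⟨rfl, rfl⟩ | ⟨rfl, rfl⟩⟩ := (hT _ _).1 he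
        · exact ⟨l, rfl⟩
        · exact ⟨l, Subtype.ext Sym2.eq_swap⟩
  rw [hcard]
  simp

/-- No two edges of `T` cross. -/
def Noncrossing (T : SimpleGraph (Fin (n + 1))) : Prop :=
  ∀ ⦃x y u v⦄, T.Adj x y → T.Adj u v → x < u → u < y → y < v → False

/-- With two crossing strands, the half-open interval of the later one would contain exactly one end
of the earlier one. -/
lemma HasStrands.noncrossing (hT : HasStrands T a b) (h : IsExcPairs a b) : Noncrossing T := by
  intro x y u v hxy huv h1 h2 h3
  obtain ⟨l, rfl, rfl⟩ := hT.exists_of_lt h (h1.trans h2) hxy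
  obtain ⟨m, rfl, rfl⟩ := hT.exists_of_lt h (h2.trans h3) huv
  rcases lt_trichotomy l m with hlt | rfl | hlt
  · have := h.orth hlt
    have := this.2 ⟨h2, h3.le⟩
    exact absurd this.1 h1.asymm
  · exact lt_irrefl _ h1
  · have := h.orth hlt
    have := this.1 ⟨h1, h2.le⟩
    exact absurd this.2 h3.not_ge

/-- `x` lies strictly between `u` and `v`. -/
def Btw (u v x : Fin (n + 1)) : Prop := (u < x ∧ x < v) ∨ (v < x ∧ x < u)

/-- An edge separates the vertices under it from those outside, and a walk that avoids its ends
cannot change sides. -/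
lemma Noncrossing.btw_iff_of_walk (hT : Noncrossing T) {x y u v : Fin (n + 1)} (hxy : T.Adj x y)
    (p : T.Walk u v) (hx : x ∉ p.support) (hy : y ∉ p.support) : Btw x y u ↔ Btw x y v := by
  induction p with
  | nil => rfl
  | @cons u w v huw p ih =>
    simp only [SimpleGraph.Walk.support_cons, List.mem_cons, not_or] at hx hy
    rw [← ih hx.2 hy.2]
    have hxw : x ≠ w := fun h => hx.2 (h ▸ p.start_mem_support)
    have hyw : y ≠ w := fun h => hy.2 (h ▸ p.start_mem_support)
    have hxu := hx.1
    have hyu := hy.1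
    -- The eight instances cover both directions of each edge and both choices of the edge that
    -- begins further left.
    have c1 := @hT x y u w hxy huw
    have c2 := @hT x y w u hxy huw.symm
    have c3 := @hT y x u w hxy.symm huw
    have c4 := @hT y x w u hxy.symm huw.symm
    have c5 := @hT u w x y huw hxy
    have c6 := @hT w u x y huw.symm hxy
    have c7 := @hT u w y x huw hxy.symm
    have c8 := @hT w u y x huw.symm hxy.symm
    simp only [Btw]
    grind

/-- Disjoint walks do not cross: one end of the first lies between the ends of the second if and
only if the other one does. -/
lemma Noncrossing.btw_iff_of_disjoint (hT : Noncrossing T) {x y u v : Fin (n + 1)}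
    (p : T.Walk x y) (q : T.Walk u v) (hpq : ∀ z ∈ p.support, z ∉ q.support) :
    Btw u v x ↔ Btw u v y := by
  induction p with
  | nil => rfl
  | @cons x w y hxw p ih =>
    simp only [SimpleGraph.Walk.support_cons, List.mem_cons, forall_eq_or_imp] at hpq
    rw [← ih hpq.2]
    have hx := hpq.1
    have hw := hpq.2 w p.start_mem_support
    have h1 := hT.btw_iff_of_walk hxw q hx hw
    have hxu : x ≠ u := fun h => hx (h ▸ q.start_mem_support)
    have hxv : x ≠ v := fun h => hx (h ▸ q.end_mem_support)
    have hwu : w ≠ u := fun h => hw (h ▸ q.start_mem_support)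
    have hwv : w ≠ v := fun h => hw (h ▸ q.end_mem_support)
    simp only [Btw] at h1 ⊢
    grind

end DimVec

/-! ### The rooted tree -/

section Tree

variable {n : ℕ} {T : SimpleGraph (Fin (n + 1))}

/-- `v` is a descendant of `u` in the tree `T` with root `0`. -/
def Desc (T : SimpleGraph (Fin (n + 1))) (u v : Fin (n + 1)) : Prop :=
  ∃ p : T.Walk 0 v, p.IsPath ∧ u ∈ p.support

/-- The edge from `u` to `v` is oriented away from the root `0`. -/
def Out (T : SimpleGraph (Fin (n + 1))) (u v : Fin (n + 1)) : Prop :=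
  T.Adj u v ∧ Desc T u v

lemma orientedRight_iff {i j : Fin (n + 1)} : OrientedRight T i j ↔ i < j ∧ Out T i j := Iff.rfl

lemma orientedLeft_iff {i j : Fin (n + 1)} : OrientedLeft T i j ↔ i < j ∧ Out T j i :=
  and_congr_right fun _ => and_congr_left fun _ => T.adj_comm _ _

variable (hT : T.IsTree)

include hT

lemma exists_path (v : Fin (n + 1)) : ∃ p : T.Walk 0 v, p.IsPath :=
  (hT.existsUnique_path 0 v).exists

lemma path_eq {v : Fin (n + 1)} {p q : T.Walk 0 v} (hp : p.IsPath) (hq : q.IsPath) : p = q :=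
  (hT.existsUnique_path 0 v).unique hp hq

lemma Out.notMem_support {u v : Fin (n + 1)} (h : Out T u v) {p : T.Walk 0 u} (hp : p.IsPath) :
    v ∉ p.support := by
  classical
  obtain ⟨hadj, q, hq, hu⟩ := h
  rw [path_eq hT hp (hq.takeUntil hu)]
  exact SimpleGraph.Walk.endpoint_notMem_support_takeUntil hq hu hadj.ne'

lemma Out.isPath_concat {u v : Fin (n + 1)} (h : Out T u v) {p : T.Walk 0 u} (hp : p.IsPath) :
    (p.concat h.1).IsPath :=
  hp.concat (h.notMem_support hT hp) h.1

lemma out_or_out {u v : Fin (n + 1)} (h : T.Adj u v) : Out T u v ∨ Out T v u := by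
  obtain ⟨p, hp⟩ := exists_path hT u
  by_cases hv : v ∈ p.support
  · exact Or.inr ⟨h.symm, p, hp, hv⟩
  · exact Or.inl ⟨h, p.concat h, hp.concat hv h, by
      rw [SimpleGraph.Walk.support_concat]; simp⟩

lemma Out.asymm {u v : Fin (n + 1)} (h : Out T u v) : ¬ Out T v u := by
  rintro ⟨_, p, hp, hv⟩
  exact h.notMem_support hT hp hv

lemma Out.unique {u u' v : Fin (n + 1)} (h : Out T u v) (h' : Out T u' v) : u = u' := by
  obtain ⟨p, hp⟩ := exists_path hT u
  obtain ⟨p', hp'⟩ := exists_path hT u'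
  have := path_eq hT (h.isPath_concat hT hp) (h'.isPath_concat hT hp')
  exact (SimpleGraph.Walk.concat_inj this).1

lemma Desc.eq_zero {u : Fin (n + 1)} (h : Desc T u 0) : u = 0 := by
  obtain ⟨p, hp, hu⟩ := h
  rw [path_eq hT hp SimpleGraph.Walk.IsPath.nil] at hu
  simpa using hu

lemma not_out_zero (u : Fin (n + 1)) : ¬ Out T u 0 := fun h => h.1.ne (h.2.eq_zero hT)

lemma exists_out {v : Fin (n + 1)} (hv : v ≠ 0) : ∃ u, Out T u v := by
  obtain ⟨p, hp⟩ := exists_path hT v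
  have hnil : ¬ p.Nil := fun h => hv h.eq.symm
  exact ⟨p.penultimate, p.adj_penultimate hnil, p, hp, p.getVert_mem_support _⟩

lemma out_induction {P : Fin (n + 1) → Prop} (h0 : P 0) (h1 : ∀ u v, Out T u v → P u → P v)
    (v : Fin (n + 1)) : P v := by
  suffices ∀ m : ℕ, ∀ v, ∀ p : T.Walk 0 v, p.IsPath → p.length = m → P v by
    obtain ⟨p, hp⟩ := exists_path hT v
    exact this _ v p hp rfl
  intro m
  induction m with
  | zero =>
    intro v p _ hl
    rwa [← SimpleGraph.Walk.eq_of_length_eq_zero hl]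
  | succ m ih =>
    intro v p hp hl
    have hv : v ≠ 0 := by
      rintro rfl
      rw [path_eq hT hp SimpleGraph.Walk.IsPath.nil] at hl
      simp at hl
    obtain ⟨u, hu⟩ := exists_out hT hv
    obtain ⟨q, hq⟩ := exists_path hT u
    refine h1 u v hu (ih u q hq ?_)
    rw [path_eq hT hp (hu.isPath_concat hT hq), SimpleGraph.Walk.length_concat] at hl
    omega

lemma desc_self (v : Fin (n + 1)) : Desc T v v := by
  obtain ⟨p, hp⟩ := exists_path hT v
  exact ⟨p, hp, p.end_mem_support⟩

/-- The path to `v` is the path to `u` followed by `v`, so only `v` itself can be the ancestor that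
tells them apart. -/
lemma Out.desc_iff {u v w : Fin (n + 1)} (h : Out T u v) (hv : v ≠ w) :
    Desc T w u ↔ Desc T w v := by
  obtain ⟨p, hp⟩ := exists_path hT u
  have hpv := h.isPath_concat hT hp
  constructor
  · rintro ⟨q, hq, hw⟩
    rw [path_eq hT hq hp] at hw
    exact ⟨_, hpv, by rw [SimpleGraph.Walk.support_concat]; simp [hw]⟩
  · rintro ⟨q, hq, hw⟩
    rw [path_eq hT hq hpv, SimpleGraph.Walk.support_concat] at hw
    simp only [List.mem_append, List.mem_singleton] at hw
    exact ⟨p, hp, hw.resolve_right hv.symm⟩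

lemma Out.not_desc {u v : Fin (n + 1)} (h : Out T u v) : ¬ Desc T v u := fun ⟨_, hp, hv⟩ =>
  h.notMem_support hT hp hv

lemma Desc.exists_walk {w v : Fin (n + 1)} (h : Desc T w v) :
    ∃ p : T.Walk w v, ∀ z ∈ p.support, Desc T w z := by
  revert h
  have hself : ∃ p : T.Walk w w, ∀ z ∈ p.support, Desc T w z :=
    ⟨SimpleGraph.Walk.nil, by simpa using desc_self hT w⟩
  induction v using out_induction hT with
  | h0 =>
    intro h
    obtain rfl := h.eq_zero hT
    exact hself
  | h1 u v huv ih =>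
    intro h
    by_cases hv : v = w
    · rw [hv]
      exact hself
    · obtain ⟨p, hp⟩ := ih ((huv.desc_iff hT hv).2 h)
      refine ⟨p.concat huv.1, fun z hz => ?_⟩
      rw [SimpleGraph.Walk.support_concat] at hz
      simp only [List.mem_append, List.mem_singleton] at hz
      rcases hz with hz | rfl
      · exact hp z hz
      · exact h

/-- Ancestors of a nondescendant of `w` are nondescendants. With `Desc.exists_walk`, both sides of
the cut above `w` are connected, so that noncrossing applies to walks in them. -/
lemma exists_walk_of_not_desc {w v : Fin (n + 1)} (h : ¬ Desc T w v) :
    ∃ p : T.Walk 0 v, ∀ z ∈ p.support, ¬ Desc T w z := by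
  revert h
  induction v using out_induction hT with
  | h0 =>
    intro h
    exact ⟨SimpleGraph.Walk.nil, by simpa using h⟩
  | h1 u v huv ih =>
    intro h
    have hv : v ≠ w := by
      rintro rfl
      exact h (desc_self hT v)
    obtain ⟨p, hp⟩ := ih fun hu => h ((huv.desc_iff hT hv).1 hu)
    refine ⟨p.concat huv.1, fun z hz => ?_⟩
    rw [SimpleGraph.Walk.support_concat] at hz
    simp only [List.mem_append, List.mem_singleton] at hz
    rcases hz with hz | rfl
    · exact hp z hz
    · exact h

/-- No vertex outside of the descendants of `w` lies strictly between the ends of a walk inside of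
them. -/
lemma not_btw_of_not_desc (hN : Noncrossing T) {w r s x : Fin (n + 1)} (q : T.Walk r s)
    (hq : ∀ z ∈ q.support, Desc T w z) (hx : ¬ Desc T w x) : ¬ Btw r s x := by
  obtain ⟨p, hp⟩ := exists_walk_of_not_desc hT hx
  rw [← hN.btw_iff_of_disjoint p q fun z hz hz' => hp z hz (hq z hz')]
  simp [Btw]

/-- If the edges from `u` to `v` and from `v` to `w` are oriented away from the root, then `u` does
not lie strictly between `v` and `w`. -/
lemma Out.not_btw (hN : Noncrossing T) {u v w : Fin (n + 1)} (h : Out T u v) (h' : Out T v w) :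
    ¬ Btw v w u := by
  refine not_btw_of_not_desc hT hN h'.1.toWalk (w := v) ?_ (h.not_desc hT)
  intro z hz
  simp only [SimpleGraph.Walk.support_cons, SimpleGraph.Walk.support_nil, List.mem_cons,
    List.not_mem_nil, or_false] at hz
  rcases hz with rfl | rfl
  · exact desc_self hT _
  · exact h'.2

end Tree

/-! ### The ternary tree -/

section Nodes

variable {n : ℕ} {T : SimpleGraph (Fin (n + 1))}

/-- The strand `c(x,y)` is the child with letter `l` of the strand `c(i,j)`. -/
def Child (T : SimpleGraph (Fin (n + 1))) (i j x y : Fin (n + 1)) : Letter → Prop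
  | Letter.a => (OrientedRight T i j ∧ x = i ∧ IsGreatest {x | i < x ∧ x < j ∧ T.Adj i x} y) ∨
      (OrientedLeft T i j ∧ y = j ∧ IsLeast {x | i < x ∧ x < j ∧ T.Adj x j} x)
  | Letter.b => (OrientedRight T i j ∧ y = j ∧ IsLeast {y | i < y ∧ y < j ∧ T.Adj y j} x) ∨
      (OrientedLeft T i j ∧ x = i ∧ IsGreatest {y | i < y ∧ y < j ∧ T.Adj i y} y)
  | Letter.c => (OrientedRight T i j ∧ x = j ∧ IsGreatest {z | j < z ∧ T.Adj j z} y) ∨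
      (OrientedLeft T i j ∧ y = i ∧ IsLeast {z | z < i ∧ T.Adj z i} x)

/-- Puts the six child constructors into one relation, for induction on labels from the right. -/
lemma isNode_iff {w : List Letter} {x y : Fin (n + 1)} :
    IsNode T w x y ↔ (w = [] ∧ x = 0 ∧ IsGreatest {m | T.Adj 0 m} y) ∨
      ∃ w' l i j, w = w' ++ [l] ∧ IsNode T w' i j ∧ Child T i j x y l := by
  constructor
  · intro h
    cases h with
    | root h => exact Or.inl ⟨rfl, rfl, h⟩
    | right_a h ho hx => exact Or.inr ⟨_, _, _, _, rfl, h, Or.inl ⟨ho, rfl, hx⟩⟩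
    | right_b h ho hx => exact Or.inr ⟨_, _, _, _, rfl, h, Or.inl ⟨ho, rfl, hx⟩⟩
    | right_c h ho hx => exact Or.inr ⟨_, _, _, _, rfl, h, Or.inl ⟨ho, rfl, hx⟩⟩
    | left_a h ho hx => exact Or.inr ⟨_, _, _, _, rfl, h, Or.inr ⟨ho, rfl, hx⟩⟩
    | left_b h ho hx => exact Or.inr ⟨_, _, _, _, rfl, h, Or.inr ⟨ho, rfl, hx⟩⟩
    | left_c h ho hx => exact Or.inr ⟨_, _, _, _, rfl, h, Or.inr ⟨ho, rfl, hx⟩⟩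
  · rintro (⟨rfl, rfl, h⟩ | ⟨w, l, i, j, rfl, h, hl⟩)
    · exact IsNode.root h
    · cases l with
      | a =>
        rcases hl with ⟨ho, rfl, hx⟩ | ⟨ho, rfl, hx⟩
        · exact h.right_a ho hx
        · exact h.left_a ho hx
      | b =>
        rcases hl with ⟨ho, rfl, hx⟩ | ⟨ho, rfl, hx⟩
        · exact h.right_b ho hx
        · exact h.left_b ho hx
      | c =>
        rcases hl with ⟨ho, rfl, hx⟩ | ⟨ho, rfl, hx⟩
        · exact h.right_c ho hx
        · exact h.left_c ho hx

variable (hT : T.IsTree)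

include hT

lemma not_right_and_left {i j : Fin (n + 1)} (h : OrientedRight T i j) : ¬ OrientedLeft T i j :=
  fun h' => (orientedRight_iff.1 h).2.asymm hT (orientedLeft_iff.1 h').2

lemma right_or_left {i j : Fin (n + 1)} (hij : i < j) (h : T.Adj i j) :
    OrientedRight T i j ∨ OrientedLeft T i j := by
  rw [orientedRight_iff, orientedLeft_iff]
  exact (out_or_out hT h).imp (fun h => ⟨hij, h⟩) fun h => ⟨hij, h⟩

lemma right_zero {y : Fin (n + 1)} (h : T.Adj 0 y) : OrientedRight T 0 y :=
  ⟨Fin.pos_of_ne_zero h.ne', h, ((out_or_out hT h).resolve_right (not_out_zero hT y)).2⟩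

variable (hN : Noncrossing T)

include hN

/-- A child with letter `a` or `c` has the orientation of its parent, a child with letter `b` the
opposite one. -/
lemma Child.orientation {i j x y : Fin (n + 1)} {l : Letter} (h : Child T i j x y l) :
    (OrientedRight T x y ∧ ((OrientedRight T i j ∧ l ≠ Letter.b) ∨
      (OrientedLeft T i j ∧ l = Letter.b))) ∨
    (OrientedLeft T x y ∧ ((OrientedLeft T i j ∧ l ≠ Letter.b) ∨
      (OrientedRight T i j ∧ l = Letter.b))) := by
  cases l with
  | a =>
    rcases h with ⟨ho, rfl, ⟨h1, h2, h3⟩, -⟩ | ⟨ho, rfl, ⟨h1, h2, h3⟩, -⟩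
    · refine Or.inl ⟨(right_or_left hT h1 h3).resolve_right fun hl => ?_,
        Or.inl ⟨ho, Letter.noConfusion⟩⟩
      -- Otherwise `y → i → j` would lead away from the root with `y` under the edge from `i` to
      -- `j`.
      exact (orientedLeft_iff.1 hl).2.not_btw hT hN ho.2 (Or.inl ⟨h1, h2⟩)
    · refine Or.inr ⟨(right_or_left hT h2 h3).resolve_left fun hr => ?_,
        Or.inl ⟨ho, Letter.noConfusion⟩⟩
      exact (orientedRight_iff.1 hr).2.not_btw hT hN (orientedLeft_iff.1 ho).2 (Or.inr ⟨h1, h2⟩)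
  | b =>
    rcases h with ⟨ho, rfl, ⟨h1, h2, h3⟩, -⟩ | ⟨ho, rfl, ⟨h1, h2, h3⟩, -⟩
    · refine Or.inr ⟨(right_or_left hT h2 h3).resolve_left fun hr => ?_, Or.inr ⟨ho, rfl⟩⟩
      -- The right end is already entered from `i`, and a vertex is entered by only one edge.
      exact h1.ne ((orientedRight_iff.1 ho).2.unique hT (orientedRight_iff.1 hr).2)
    · refine Or.inl ⟨(right_or_left hT h1 h3).resolve_right fun hl => ?_, Or.inr ⟨ho, rfl⟩⟩
      exact h2.ne' ((orientedLeft_iff.1 ho).2.unique hT (orientedLeft_iff.1 hl).2)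
  | c =>
    rcases h with ⟨ho, rfl, ⟨h1, h2⟩, -⟩ | ⟨ho, rfl, ⟨h1, h2⟩, -⟩
    · refine Or.inl ⟨(right_or_left hT h1 h2).resolve_right fun hl => ?_,
        Or.inl ⟨ho, Letter.noConfusion⟩⟩
      exact (ho.1.trans h1).ne ((orientedRight_iff.1 ho).2.unique hT (orientedLeft_iff.1 hl).2)
    · refine Or.inr ⟨(right_or_left hT h1 h2).resolve_left fun hr => ?_,
        Or.inl ⟨ho, Letter.noConfusion⟩⟩
      exact (h1.trans ho.1).ne' ((orientedLeft_iff.1 ho).2.unique hT (orientedRight_iff.1 hr).2)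

lemma IsNode.orientation {w : List Letter} {i j : Fin (n + 1)} (h : IsNode T w i j) :
    (OrientedRight T i j ∧ Even (w.count Letter.b)) ∨
      (OrientedLeft T i j ∧ ¬ Even (w.count Letter.b)) := by
  induction w using List.reverseRecOn generalizing i j with
  | nil =>
    rcases isNode_iff.1 h with ⟨-, rfl, h, -⟩ | ⟨w, l, _, _, hw, -⟩
    · exact Or.inl ⟨right_zero hT h, by simp⟩
    · simp at hw
  | append_singleton w l ih =>
    rcases isNode_iff.1 h with ⟨hw, -⟩ | ⟨w', l', i', j', hw, h', hc⟩
    · simp at hw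
    · obtain ⟨rfl, hl⟩ := List.append_inj' hw rfl
      obtain rfl : l = l' := by simpa using hl
      have hx := not_right_and_left hT (i := i') (j := j')
      rcases hc.orientation hT hN with ⟨h1, ⟨h2, h3⟩ | ⟨h2, rfl⟩⟩ | ⟨h1, ⟨h2, h3⟩ | ⟨h2, rfl⟩⟩ <;>
      rcases ih h' with ⟨h4, h5⟩ | ⟨h4, h5⟩ <;>
      simp_all [List.count_append, Nat.even_add_one]

lemma IsNode.lt {w : List Letter} {i j : Fin (n + 1)} (h : IsNode T w i j) : i < j := by
  rcases h.orientation hT hN with h | h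
  exacts [h.1.1, h.1.1]

lemma IsNode.adj {w : List Letter} {i j : Fin (n + 1)} (h : IsNode T w i j) : T.Adj i j := by
  rcases h.orientation hT hN with h | h
  exacts [h.1.2.1, h.1.2.1]

lemma IsNode.even_iff {w : List Letter} {i j : Fin (n + 1)} (h : IsNode T w i j) :
    Even (w.count Letter.b) ↔ OrientedRight T i j := by
  rcases h.orientation hT hN with h | h
  · simp [h]
  · simp only [h, false_iff]
    exact fun h' => not_right_and_left hT h' h.1

omit hN in
lemma Child.right_unique {i j x y x' y' : Fin (n + 1)} {l : Letter} (h : Child T i j x y l)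
    (h' : Child T i j x' y' l) : x = x' ∧ y = y' := by
  have hx := not_right_and_left hT (i := i) (j := j)
  cases l <;>
  rcases h with ⟨ho, rfl, h⟩ | ⟨ho, rfl, h⟩ <;>
  rcases h' with ⟨ho', rfl, h'⟩ | ⟨ho', rfl, h'⟩ <;>
  first
  | exact ⟨rfl, h.unique h'⟩
  | exact ⟨h.unique h', rfl⟩
  | exact absurd ho' (hx ho)
  | exact absurd ho (hx ho')

omit hN in
lemma IsNode.pair_unique {w : List Letter} {i j i' j' : Fin (n + 1)} (h : IsNode T w i j)
    (h' : IsNode T w i' j') : i = i' ∧ j = j' := by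
  induction w using List.reverseRecOn generalizing i j i' j' with
  | nil =>
    rcases isNode_iff.1 h with ⟨-, rfl, hm⟩ | ⟨w, l, _, _, hw, -⟩
    · rcases isNode_iff.1 h' with ⟨-, rfl, hm'⟩ | ⟨w, l, _, _, hw, -⟩
      · exact ⟨rfl, hm.unique hm'⟩
      · simp at hw
    · simp at hw
  | append_singleton w l ih =>
    rcases isNode_iff.1 h with ⟨hw, -⟩ | ⟨w1, l1, i1, j1, hw, h1, hc⟩
    · simp at hw
    rcases isNode_iff.1 h' with ⟨hw', -⟩ | ⟨w2, l2, i2, j2, hw', h2, hc'⟩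
    · simp at hw'
    obtain ⟨rfl, hl⟩ := List.append_inj' hw rfl
    obtain rfl : l = l1 := by simpa using hl
    obtain ⟨rfl, hl⟩ := List.append_inj' hw' rfl
    obtain rfl : l = l2 := by simpa using hl
    obtain ⟨rfl, rfl⟩ := ih h1 h2
    exact hc.right_unique hT hc'

/-- The parent of a strand that is oriented to the right. -/
lemma Child.of_right {i j x y : Fin (n + 1)} {l : Letter} (h : Child T i j x y l)
    (hr : OrientedRight T x y) :
    (i = x ∧ y < j ∧ T.Adj x j ∧ (∀ z, x < z → z < j → T.Adj x z → z ≤ y) ∧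
      ((l = Letter.a ∧ OrientedRight T x j) ∨ (l = Letter.b ∧ OrientedLeft T x j))) ∨
    (j = x ∧ l = Letter.c ∧ Out T i x ∧ ∀ z, x < z → T.Adj x z → z ≤ y) := by
  have ho := h.orientation hT hN
  have hx := not_right_and_left hT hr
  cases l with
  | a =>
    rcases h with ⟨ho, rfl, ⟨h1, h2, h3⟩, h4⟩ | ⟨hl, -⟩
    · exact Or.inl ⟨rfl, h2, ho.2.1, fun z h1 h2 h3 => h4 ⟨h1, h2, h3⟩, Or.inl ⟨rfl, ho⟩⟩
    · have := not_right_and_left hT (i := i) (j := j)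
      simp_all
  | b =>
    rcases h with ⟨hl, -⟩ | ⟨ho, rfl, ⟨h1, h2, h3⟩, h4⟩
    · have := not_right_and_left hT (i := i) (j := j)
      simp_all
    · exact Or.inl ⟨rfl, h2, ho.2.1, fun z h1 h2 h3 => h4 ⟨h1, h2, h3⟩, Or.inr ⟨rfl, ho⟩⟩
  | c =>
    rcases h with ⟨ho, rfl, ⟨h1, h2⟩, h4⟩ | ⟨hl, -⟩
    · exact Or.inr ⟨rfl, rfl, ho.2, fun z h1 h2 => h4 ⟨h1, h2⟩⟩
    · have := not_right_and_left hT (i := i) (j := j)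
      simp_all

/-- The parent of a strand that is oriented to the left. -/
lemma Child.of_left {i j x y : Fin (n + 1)} {l : Letter} (h : Child T i j x y l)
    (hr : OrientedLeft T x y) :
    (j = y ∧ i < x ∧ T.Adj i y ∧ (∀ z, i < z → z < y → T.Adj z y → x ≤ z) ∧
      ((l = Letter.b ∧ OrientedRight T i y) ∨ (l = Letter.a ∧ OrientedLeft T i y))) ∨
    (i = y ∧ l = Letter.c ∧ Out T j y ∧ ∀ z, z < y → T.Adj z y → x ≤ z) := by
  have ho := h.orientation hT hN
  have hx := fun h => not_right_and_left hT h hr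
  cases l with
  | a =>
    rcases h with ⟨hl, -⟩ | ⟨ho, rfl, ⟨h1, h2, h3⟩, h4⟩
    · have := not_right_and_left hT (i := i) (j := j)
      simp_all
    · exact Or.inl ⟨rfl, h1, ho.2.1, fun z h1 h2 h3 => h4 ⟨h1, h2, h3⟩, Or.inr ⟨rfl, ho⟩⟩
  | b =>
    rcases h with ⟨ho, rfl, ⟨h1, h2, h3⟩, h4⟩ | ⟨hl, -⟩
    · exact Or.inl ⟨rfl, h1, ho.2.1, fun z h1 h2 h3 => h4 ⟨h1, h2, h3⟩, Or.inl ⟨rfl, ho⟩⟩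
    · have := not_right_and_left hT (i := i) (j := j)
      simp_all
  | c =>
    rcases h with ⟨hl, -⟩ | ⟨ho, rfl, ⟨h1, h2⟩, h4⟩
    · have := not_right_and_left hT (i := i) (j := j)
      simp_all
    · exact Or.inr ⟨rfl, rfl, (orientedLeft_iff.1 ho).2, fun z h1 h2 => h4 ⟨h1, h2⟩⟩

/-- A longer strand at the common end excludes a parent of type `c`, and maximality or minimality
excludes two different longer ones. Types `a` and `b` differ by the orientation of the parent. -/
lemma Child.left_unique {i j i' j' x y : Fin (n + 1)} {l l' : Letter} (h : Child T i j x y l)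
    (h' : Child T i' j' x y l') : l = l' ∧ i = i' ∧ j = j' := by
  rcases h.orientation hT hN with ⟨ho, -⟩ | ⟨ho, -⟩
  · rcases h.of_right hT hN ho with ⟨rfl, h1, h2, h3, h4⟩ | ⟨rfl, rfl, h1, h2⟩ <;>
    rcases h'.of_right hT hN ho with ⟨rfl, h1', h2', h3', h4'⟩ | ⟨rfl, rfl, h1', h2'⟩
    · obtain rfl : j = j' := by
        by_contra hne
        rcases lt_or_gt_of_ne hne with hlt | hlt
        · exact absurd (h3' j (ho.1.trans h1) hlt h2) h1.not_ge
        · exact absurd (h3 j' (ho.1.trans h1') hlt h2') h1'.not_ge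
      have := not_right_and_left hT (i := i') (j := j)
      refine ⟨?_, rfl, rfl⟩
      rcases h4 with ⟨rfl, h4⟩ | ⟨rfl, h4⟩ <;> rcases h4' with ⟨rfl, h4'⟩ | ⟨rfl, h4'⟩ <;> simp_all
    · exact absurd (h2' j (ho.1.trans h1) h2) h1.not_ge
    · exact absurd (h2 j' (ho.1.trans h1') h2') h1'.not_ge
    · exact ⟨rfl, h1.unique hT h1', rfl⟩
  · rcases h.of_left hT hN ho with ⟨rfl, h1, h2, h3, h4⟩ | ⟨rfl, rfl, h1, h2⟩ <;>
    rcases h'.of_left hT hN ho with ⟨rfl, h1', h2', h3', h4'⟩ | ⟨rfl, rfl, h1', h2'⟩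
    · obtain rfl : i = i' := by
        by_contra hne
        rcases lt_or_gt_of_ne hne with hlt | hlt
        · exact absurd (h3 i' hlt (h1'.trans ho.1) h2') h1'.not_ge
        · exact absurd (h3' i hlt (h1.trans ho.1) h2) h1.not_ge
      have := not_right_and_left hT (i := i) (j := j')
      refine ⟨?_, rfl, rfl⟩
      rcases h4 with ⟨rfl, h4⟩ | ⟨rfl, h4⟩ <;> rcases h4' with ⟨rfl, h4'⟩ | ⟨rfl, h4'⟩ <;> simp_all
    · exact absurd (h2' i (h1.trans ho.1) h2) h1.not_ge
    · exact absurd (h2 i' (h1'.trans ho.1) h2') h1'.not_ge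
    · exact ⟨rfl, rfl, h1.unique hT h1'⟩

/-- A parent would be a longer strand at `0` or a strand entering `0`. -/
lemma Child.not_root {i j y : Fin (n + 1)} {l : Letter} (h : Child T i j 0 y l)
    (hy : IsGreatest {m | T.Adj 0 m} y) : False := by
  rcases h.of_right hT hN (right_zero hT hy.1) with ⟨rfl, h1, h2, -⟩ | ⟨rfl, -, h1, -⟩
  · exact absurd (hy.2 h2) h1.not_ge
  · exact not_out_zero hT _ h1

lemma IsNode.label_unique {w w' : List Letter} {i j : Fin (n + 1)} (h : IsNode T w i j)
    (h' : IsNode T w' i j) : w = w' := by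
  induction w using List.reverseRecOn generalizing i j w' with
  | nil =>
    rcases isNode_iff.1 h with ⟨-, rfl, hm⟩ | ⟨w, l, _, _, hw, -⟩
    · rcases isNode_iff.1 h' with ⟨rfl, -⟩ | ⟨w, l, _, _, -, -, hc⟩
      · rfl
      · exact (hc.not_root hT hN hm).elim
    · simp at hw
  | append_singleton w l ih =>
    rcases isNode_iff.1 h with ⟨hw, -⟩ | ⟨w1, l1, i1, j1, hw, h1, hc⟩
    · simp at hw
    obtain ⟨rfl, hl⟩ := List.append_inj' hw rfl
    obtain rfl : l = l1 := by simpa using hl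
    rcases isNode_iff.1 h' with ⟨-, rfl, hm'⟩ | ⟨w2, l2, i2, j2, rfl, h2, hc'⟩
    · exact (hc.not_root hT hN hm').elim
    · obtain ⟨rfl, rfl, rfl⟩ := hc.left_unique hT hN hc'
      rw [ih h1 h2]

/-- The hypothesis `hpar` makes the edge entering `t` a node. Going from the longest right edge at
`t` down, each edge is the child `a` or `b` of the next longer one. The longest one is the root or
the child `c` of the entering edge. -/
lemma exists_isNode_right {t : Fin (n + 1)}
    (hpar : ∀ u, Out T u t → (u < t → ∃ w, IsNode T w u t) ∧ (t < u → ∃ w, IsNode T w t u))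
    (y : Fin (n + 1)) (hty : t < y) (hy : Out T t y) : ∃ w, IsNode T w t y := by
  induction y using WellFoundedGT.induction with
  | ind y ih =>
    by_cases hex : ∃ z, y < z ∧ T.Adj t z
    · obtain ⟨z, ⟨hz1, hz2⟩, hz3⟩ :=
        Set.exists_min_image {z | y < z ∧ T.Adj t z} id (Set.toFinite _) hex
      have hg : IsGreatest {x | t < x ∧ x < z ∧ T.Adj t x} y :=
        ⟨⟨hty, hz1, hy.1⟩, fun x hx => not_lt.1 fun hlt => (hz3 x ⟨hlt, hx.2.2⟩).not_gt hx.2.1⟩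
      rcases out_or_out hT hz2 with ho | ho
      · obtain ⟨w, hw⟩ := ih z hz1 (hty.trans hz1) ho
        exact ⟨_, hw.right_a (orientedRight_iff.2 ⟨hty.trans hz1, ho⟩) hg⟩
      · obtain ⟨w, hw⟩ := (hpar z ho).2 (hty.trans hz1)
        exact ⟨_, hw.left_b (orientedLeft_iff.2 ⟨hty.trans hz1, ho⟩) hg⟩
    · have hmax : ∀ z, T.Adj t z → z ≤ y := fun z hz => not_lt.1 fun hlt => hex ⟨z, hlt, hz⟩
      by_cases ht : t = 0
      · subst ht
        exact ⟨_, IsNode.root ⟨hy.1, fun z hz => hmax z hz⟩⟩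
      · obtain ⟨u, hu⟩ := exists_out hT ht
        -- If `t` were entered from the right, then `u ≤ y` by maximality, and `u` would lie under
        -- the edge from `t` to `y`.
        have hut : u < t := by
          by_contra hle
          have h1 : t < u := lt_of_le_of_ne (not_lt.1 hle) hu.1.ne'
          have h2 : u ≠ y := by
            rintro rfl
            exact hu.asymm hT hy
          exact hu.not_btw hT hN hy (Or.inl ⟨h1, lt_of_le_of_ne (hmax u hu.1.symm) h2⟩)
        obtain ⟨w, hw⟩ := (hpar u hu).1 hut
        exact ⟨_, hw.right_c (orientedRight_iff.2 ⟨hut, hu⟩)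
          ⟨⟨hty, hy.1⟩, fun z hz => hmax z hz.2⟩⟩

lemma exists_isNode_left {t : Fin (n + 1)}
    (hpar : ∀ u, Out T u t → (u < t → ∃ w, IsNode T w u t) ∧ (t < u → ∃ w, IsNode T w t u))
    (x : Fin (n + 1)) (hxt : x < t) (hx : Out T t x) : ∃ w, IsNode T w x t := by
  induction x using WellFoundedLT.induction with
  | ind x ih =>
    by_cases hex : ∃ z, z < x ∧ T.Adj z t
    · obtain ⟨z, ⟨hz1, hz2⟩, hz3⟩ :=
        Set.exists_max_image {z | z < x ∧ T.Adj z t} id (Set.toFinite _) hex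
      have hg : IsLeast {y | z < y ∧ y < t ∧ T.Adj y t} x :=
        ⟨⟨hz1, hxt, hx.1.symm⟩,
          fun y hy => not_lt.1 fun hlt => (hz3 y ⟨hlt, hy.2.2⟩).not_gt hy.1⟩
      rcases out_or_out hT hz2 with ho | ho
      · obtain ⟨w, hw⟩ := (hpar z ho).1 (hz1.trans hxt)
        exact ⟨_, hw.right_b (orientedRight_iff.2 ⟨hz1.trans hxt, ho⟩) hg⟩
      · obtain ⟨w, hw⟩ := ih z hz1 (hz1.trans hxt) ho
        exact ⟨_, hw.left_a (orientedLeft_iff.2 ⟨hz1.trans hxt, ho⟩) hg⟩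
    · have hmin : ∀ z, T.Adj z t → x ≤ z := fun z hz => not_lt.1 fun hlt => hex ⟨z, hlt, hz⟩
      obtain ⟨u, hu⟩ := exists_out hT (Fin.ne_zero_of_lt hxt)
      have htu : t < u := by
        by_contra hle
        have h1 : u < t := lt_of_le_of_ne (not_lt.1 hle) hu.1.ne
        have h2 : x ≠ u := by
          rintro rfl
          exact hu.asymm hT hx
        exact hu.not_btw hT hN hx (Or.inr ⟨lt_of_le_of_ne (hmin u hu.1) h2, h1⟩)
      obtain ⟨w, hw⟩ := (hpar u hu).2 htu
      exact ⟨_, hw.left_c (orientedLeft_iff.2 ⟨htu, hu⟩)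
        ⟨⟨hxt, hx.1.symm⟩, fun z hz => hmin z hz.2⟩⟩

/-- Every edge is a node of the ternary tree. -/
lemma exists_isNode {i j : Fin (n + 1)} (hij : i < j) (h : T.Adj i j) :
    ∃ w, IsNode T w i j := by
  -- Induction away from the root: if the edge entering a vertex is a node, so are all edges leaving
  -- it.
  have key : ∀ t, ∀ u, Out T u t →
      (u < t → ∃ w, IsNode T w u t) ∧ (t < u → ∃ w, IsNode T w t u) := by
    intro t
    induction t using out_induction hT with
    | h0 => exact fun u hu => (not_out_zero hT u hu).elim
    | h1 u v huv ih =>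
      intro u' hu'
      obtain rfl := huv.unique hT hu'
      exact ⟨fun h => exists_isNode_right hT hN ih v h huv,
        fun h => exists_isNode_left hT hN ih v h huv⟩
  rcases out_or_out hT h with h | h
  · exact (key j i h).1 hij
  · exact (key i j h).2 hij

end Nodes

/-! ### Orientation and relative injectivity -/

section Orientation

variable {n : ℕ} {T : SimpleGraph (Fin (n + 1))} {a b : Fin n → Fin (n + 1)}

/-- If the strand `l` is oriented to the right, then the structure map from `a l` to `b l` of a
left orthogonal interval representation is injective. -/
lemma IsExcPairs.false_of_right (h : IsExcPairs a b) (hT : HasStrands T a b) {l : Fin n}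
    (hl : Out T (a l) (b l)) {p q : Fin (n + 1)} (hp : p < a l) (hq : a l ≤ q) (hqb : q < b l)
    (horth : ∀ m < l, ((p < a m ∧ a m ≤ q) ↔ (p < b m ∧ b m ≤ q))) : False := by
  classical
  have hN := hT.noncrossing h
  have hTree := hT.isTree h
  -- Removing strand `l` cuts off the descendants of `b l`, so their indicator function changes
  -- along strand `l` only.
  have hg := h.sub_eq_diffForm (fun v => if Desc T (b l) v then 1 else 0) l (fun m hm => by
      have : Desc T (b l) (a m) ↔ Desc T (b l) (b m) := by
        rcases out_or_out hTree (hT.adj m) with ho | ho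
        · refine ho.desc_iff hTree fun hb => hm ?_
          rw [hb] at ho
          exact h.eq_of_eq (ho.unique hTree hl) hb
        · refine (ho.desc_iff hTree fun hb => ?_).symm
          rw [hb] at ho
          have h1 := ho.unique hTree hl
          have h2 := h.lt m
          rw [hb, h1] at h2
          exact h2.asymm (h.lt l)
      simp only [this])
    (by simp [desc_self hTree, hl.not_desc hTree]) (hp.le.trans hq)
    (fun t ht => by
      rw [diffForm_dimVec]
      simp only [horth t ht, sub_self])
  rw [diffForm_dimVec, if_neg (show ¬(p < b l ∧ b l ≤ q) from fun h' => hqb.not_ge h'.2),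
    if_pos (show p < a l ∧ a l ≤ q from ⟨hp, hq⟩)] at hg
  -- The indicator drops by `1` from `p` to `q`, so it is `1` at `p`.
  have hDp : Desc T (b l) p := by
    by_contra hDp
    rw [if_neg hDp] at hg
    split_ifs at hg <;> norm_num at hg
  obtain ⟨w, hw⟩ := hDp.exists_walk hTree
  exact not_btw_of_not_desc hTree hN w hw (hl.not_desc hTree) (Or.inr ⟨hp, h.lt l⟩)

/-- If the strand `l` is oriented to the left, then some longer interval with the same right end is
orthogonal to the members before `l`. -/
lemma IsExcPairs.exists_of_left (h : IsExcPairs a b) (hT : HasStrands T a b) {l : Fin n}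
    (hl : Out T (b l) (a l)) :
    ∃ p, p < a l ∧ ∀ m < l, ((p < a m ∧ a m ≤ b l) ↔ (p < b m ∧ b m ≤ b l)) := by
  have hN := hT.noncrossing h
  have hTree := hT.isTree h
  have ha0 : a l ≠ 0 := fun h0 => by
    rw [h0] at hl
    exact not_out_zero hTree _ hl
  -- The new left end is the last vertex before `a l` that is not a descendant of `a l`; the root
  -- `0` is a candidate.
  obtain ⟨p, ⟨hp1, hp2⟩, hp3⟩ := Set.exists_max_image {x | x < a l ∧ ¬ Desc T (a l) x} id
    (Set.toFinite _) ⟨0, Fin.pos_of_ne_zero ha0, fun h0 => ha0 (h0.eq_zero hTree)⟩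
  refine ⟨p, hp1, fun m hm => ?_⟩
  have hD : ∀ x, p < x → x ≤ a l → Desc T (a l) x := by
    intro x hx1 hx2
    rcases hx2.lt_or_eq with hlt | rfl
    · by_contra hx
      exact (hp3 x ⟨hlt, hx⟩).not_gt hx1
    · exact desc_self hTree _
  have hiff : Desc T (a l) (a m) ↔ Desc T (a l) (b m) := by
    rcases out_or_out hTree (hT.adj m) with ho | ho
    · refine ho.desc_iff hTree fun hb => ?_
      rw [hb] at ho
      have h1 := ho.unique hTree hl
      have h2 := h.lt m
      rw [hb, h1] at h2
      exact h2.asymm (h.lt l)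
    · refine (ho.desc_iff hTree fun hb => hm.ne ?_).symm
      rw [hb] at ho
      exact h.eq_of_eq hb (ho.unique hTree hl)
  -- A strand among the descendants of `a l` cannot pass over a nondescendant. This is used below
  -- for `b l` and for `p`.
  have hbtw : Desc T (a l) (a m) → ∀ x, ¬ Desc T (a l) x → ¬ (a m < x ∧ x < b m) := by
    intro hDa x hx hx'
    refine not_btw_of_not_desc hTree hN (hT.adj m).toWalk (w := a l) (fun z hz => ?_) hx
      (Or.inl hx')
    simp only [SimpleGraph.Walk.support_cons, SimpleGraph.Walk.support_nil, List.mem_cons,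
      List.not_mem_nil, or_false] at hz
    rcases hz with rfl | rfl
    exacts [hDa, hiff.1 hDa]
  have horth := h.orth hm
  have hlm := h.lt m
  constructor
  · rintro ⟨h1, h2⟩
    refine ⟨h1.trans hlm, not_lt.1 fun hlt => ?_⟩
    have hle : a m ≤ a l := not_lt.1 fun h3 => (horth.1 ⟨h3, h2⟩).2.not_gt hlt
    exact hbtw (hD _ h1 hle) (b l) (hl.not_desc hTree) ⟨hle.trans_lt (h.lt l), hlt⟩
  · rintro ⟨h1, h2⟩
    refine ⟨not_le.1 fun hle => ?_, hlm.le.trans h2⟩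
    have hbl : b m ≤ a l := not_lt.1 fun h3 => (horth.2 ⟨h3, h2⟩).1.not_ge (hle.trans hp1.le)
    have hDa := hiff.2 (hD _ h1 hbl)
    have hne : a m ≠ p := fun h0 => hp2 (h0 ▸ hDa)
    exact hbtw hDa p hp2 ⟨lt_of_le_of_ne hle hne, h1⟩

end Orientation

/-! ### Exceptional sequences -/

section Sequence

variable {k : Type u} [Field k] {n : ℕ} {E : Fin n → LinRep k n} {a b : Fin n → Fin (n + 1)}

lemma orth_congr_right {X V W : LinRep k n} (e : V ≅ W) : Orth X V ↔ Orth X W :=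
  ⟨fun h => h.of_retract e.inv e.hom e.inv_hom_id, fun h => h.of_retract e.hom e.inv e.hom_inv_id⟩

lemma bijective_tr_congr {X Y : LinRep k n} (e : X ≅ Y) {r s : ℕ} (h : r ≤ s) :
    Function.Bijective (tr X h) ↔ Function.Bijective (tr Y h) :=
  ⟨bijective_tr_of_retract e.inv e.hom e.inv_hom_id h,
    bijective_tr_of_retract e.hom e.inv e.hom_inv_id h⟩

variable (hab : ∀ l, a l < b l) (e : ∀ l, E l ≅ M k (a l) (b l))

include hab e

lemma IsExceptionalSequence.isExcPairs (hE : IsExceptionalSequence E) : IsExcPairs a b where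
  lt := hab
  orth {m l} hml := by
    have h1 := hE.orth l m hml
    rwa [orth_congr_right (e m), orth_M_iff _ (hab m), bijective_tr_congr (e l),
      bijective_tr_M_iff] at h1

lemma hasStrands_strandDiagram : HasStrands (strandDiagram (Set.range E)) a b := by
  have key : ∀ x y, (x < y ∧ ∃ X ∈ Set.range E, Nonempty (X ≅ M k x y)) ↔
      ∃ l, a l = x ∧ b l = y := by
    intro x y
    constructor
    · rintro ⟨hxy, _, ⟨l, rfl⟩, ⟨f⟩⟩
      exact ⟨l, interval_eq_of_iso (hab l) hxy ((e l).symm ≪≫ f)⟩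
    · rintro ⟨l, rfl, rfl⟩
      exact ⟨hab l, _, ⟨l, rfl⟩, ⟨e l⟩⟩
  intro x y
  rw [strandDiagram, SimpleGraph.fromRel_adj, key, key, exists_or]
  refine and_iff_right_of_imp ?_
  rintro (⟨l, rfl, rfl⟩ | ⟨l, rfl, rfl⟩)
  exacts [(hab l).ne, (hab l).ne']

lemma leftPerp_iff (l : Fin n) (W : LinRep k n) :
    leftPerp (⨁ fun m : Set.Iio l => E m) W ↔ ∀ m : Set.Iio l, Function.Bijective
      (tr W (show (a m).val ≤ (b m).val from (hab m).le)) := by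
  refine (orth_biproduct_iff W _).trans (forall_congr' fun m => ?_)
  rw [orth_congr_right (e m), orth_M_iff _ (hab m)]

/-- Right orientation is handled by `IsExcPairs.false_of_right`, applied to an interval summand of a
perpendicular object; left orientation by the larger interval of `IsExcPairs.exists_of_left`. -/
lemma IsExceptionalSequence.isRelInjectiveIn_iff (hE : IsExceptionalSequence E) (l : Fin n) :
    IsRelInjectiveIn E l ↔ OrientedRight (strandDiagram (Set.range E)) (a l) (b l) := by
  have h := hE.isExcPairs hab e
  have hT := hasStrands_strandDiagram hab e
  have hV := leftPerp_iff hab e l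
  have hTree := hT.isTree h
  constructor
  · intro hinj
    refine (right_or_left hTree (hab l) (hT.adj l)).resolve_right fun hleft => ?_
    obtain ⟨p, hp, horth⟩ := h.exists_of_left hT (orientedLeft_iff.1 hleft).2
    refine not_isRelInjectiveWrt_of_lt hp (hab l) (e l) ((hV _).2 fun m => ?_) hinj
    rw [bijective_tr_M_iff]
    exact horth m m.2
  · intro hright
    refine isRelInjectiveWrt_of_forall_injective (fun m : Set.Iio l => hab m) hV
      ((orth_biproduct_iff _ _).2 fun m => hE.orth l m m.2) (hab l) (e l) fun Z hZ => ?_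
    by_contra hni
    obtain ⟨p, q, hp, hq, hqb, f, r, hfr⟩ := exists_retract_of_not_injective Z _ hni
    refine h.false_of_right hT hright.2 hp hq hqb fun m hm => ?_
    exact (bijective_tr_M_iff p q _).1
      (bijective_tr_of_retract f r hfr _ ((hV Z).1 hZ ⟨m, hm⟩))

end Sequence

end LinearA

end

theorem mainTheorem8 (k : Type u) [Field k] (n : ℕ) (E : Fin n → LinearA.LinRep k n)
    (hE : LinearA.IsExceptionalSequence E) :
    -- the strand diagram is a tree, and each object of the set is exactly one strand
    (LinearA.strandDiagram (Set.range E)).IsTree ∧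
    (∀ l, ∃! p : Fin (n + 1) × Fin (n + 1), p.1 < p.2 ∧
      Nonempty (E l ≅ LinearA.M k p.1 p.2)) ∧
    -- nodes of the ternary tree correspond one to one to the objects of the set
    (∀ l, ∃! w : List LinearA.Letter, LinearA.NodeOf (Set.range E) w (E l)) ∧
    (∀ w i j, LinearA.IsNode (LinearA.strandDiagram (Set.range E)) w i j →
      ∃! l, LinearA.NodeOf (Set.range E) w (E l)) ∧
    -- a node is relatively injective iff its label has an even number of letters `b`
    (∀ l w, LinearA.NodeOf (Set.range E) w (E l) →
      (LinearA.IsRelInjectiveIn E l ↔ Even (w.count LinearA.Letter.b))) ∧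
    -- a strand is relatively injective iff it is oriented to the right
    (∀ l (i j : Fin (n + 1)), i < j → Nonempty (E l ≅ LinearA.M k i j) →
      (LinearA.IsRelInjectiveIn E l ↔
        LinearA.OrientedRight (LinearA.strandDiagram (Set.range E)) i j)) := by
  choose a b hab he using fun l => LinearA.exists_iso_M_of_isExceptional (hE.exceptional l)
  have e := fun l => (he l).some
  have h := hE.isExcPairs hab e
  have hT := LinearA.hasStrands_strandDiagram hab e
  have hTree := hT.isTree h
  have hN := hT.noncrossing h
  have heq : ∀ l i j, i < j → Nonempty (E l ≅ LinearA.M k i j) → a l = i ∧ b l = j :=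
    fun l i j hij ⟨f⟩ => LinearA.interval_eq_of_iso (hab l) hij ((e l).symm ≪≫ f)
  have hnode : ∀ l w, LinearA.NodeOf (Set.range E) w (E l) ↔
      LinearA.IsNode (LinearA.strandDiagram (Set.range E)) w (a l) (b l) := by
    intro l w
    constructor
    · rintro ⟨i, j, hw, hf⟩
      obtain ⟨rfl, rfl⟩ := heq l i j (hw.lt hTree hN) hf
      exact hw
    · exact fun hw => ⟨_, _, hw, ⟨e l⟩⟩
  refine ⟨hTree, fun l => ⟨(a l, b l), ⟨hab l, ⟨e l⟩⟩, ?_⟩, fun l => ?_, fun w i j hw => ?_,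
    fun l w hw => ?_, fun l i j hij hf => ?_⟩
  · rintro ⟨i, j⟩ ⟨hij, hf⟩
    obtain ⟨rfl, rfl⟩ := heq l i j hij hf
    rfl
  · obtain ⟨w, hw⟩ := LinearA.exists_isNode hTree hN (hab l) (hT.adj l)
    exact ⟨w, (hnode l w).2 hw, fun w' hw' => ((hnode l w').1 hw').label_unique hTree hN hw⟩
  · obtain ⟨l, rfl, rfl⟩ := hT.exists_of_lt h (hw.lt hTree hN) (hw.adj hTree hN)
    refine ⟨l, (hnode l w).2 hw, fun m hm => ?_⟩
    obtain ⟨h1, h2⟩ := ((hnode m w).1 hm).pair_unique hTree hw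
    exact h.eq_of_eq h1 h2
  · rw [hE.isRelInjectiveIn_iff hab e, ((hnode l w).1 hw).even_iff hTree hN]
  · obtain ⟨rfl, rfl⟩ := heq l i j hij hf
    exact hE.isRelInjectiveIn_iff hab e l
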